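/- **Setting.** Let $T^1,\dots,T^8$ be Hermitian traceless $3\times 3$ matrices with $\operatorname{tr}(T^AT^B)=\frac12\delta_{AB}$ (generators of $SU(3)$). Let $a_A,a_A^\dagger$ ($1\le A\le 8$) be the annihilation and creation operators of eight independent bosonic oscillators, $[a_A,a_B^\dagger]=\delta_{AB}$, acting on the bosonic Fock space with normalized vacuum $|0\rangle$, and put $a=\sum_A a_AT^A$, $a^\dagger=\sum_A a^\dagger_AT^A$ (operator-valued matrices) and $$H=\operatorname{tr}(a^\dagger a)+2-\tfrac12\operatorname{tr}(a^\dagger a^\dagger)-\tfrac12\operatorname{tr}(aa).$$ Let $|j,k\rangle=(\operatorname{tr}a^\dagger a^\dagger)^j(\operatorname{tr}a^\dagger a^\dagger a^\dagger)^k|0\rangle$ and $$\overline{|n,2\kappa\rangle}=|n,2\kappa\rangle+\sum_{t=1}^{\kappa}\Gamma_{\kappa,\kappa-t}\,|n+3t,2\kappa-2t\rangle,\qquad \Gamma_{\kappa,t}=(-24)^{t-\kappa}\frac{(\kappa+t)!}{(\kappa-t)!\,(2t)!}.$$ Let $\mathcal L_n^{a}(x)=\sum_{i=0}^n(-1)^i\binom{n+a}{n-i}\frac{x^i}{i!}$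 be the generalized Laguerre polynomials and $L_n^a=\mathcal L_n^a/(n+a)!$. Fix a cut-off $N\in\mathbb N$, let $0\le\kappa\le\lfloor N/6\rfloor$, and put $d_\kappa=\lfloor (N-6\kappa)/2\rfloor+1$. For real $E$ let $$|E,\kappa\rangle=(2E)^{3\kappa}e^{-E}\sum_{n=0}^{d_\kappa-1}L_n^{6\kappa+3}(2E)\,\overline{|n,2\kappa\rangle}.$$ The even sector at cut-off $N$ is the span of the Fock states $|j,2k\rangle$ with $2j+6k\le N$, and the Hamiltonian at cut-off $N$ is $P_NH$, where $P_N$ is the projection onto states with at most $N$ quanta. **Claim.** 1. For all $\alpha,\beta,n,m\ge0$: $\ \overline{\langle n,2\alpha|}\,\overline{m,2\beta\rangle}=\delta_{\alpha\beta}\,\delta_{nm}\,\mathcal N^\alpha(n)$ with $\mathcal N^\alpha(n)=\frac16\,\frac1{24^{2\alpha}}\,n!\,(n+6\alpha+3)!$. 2. For each $\kappa\le\lfloor N/6\rfloor$ the polynomial $\mathcal L_{d_\kappa}^{6\kappa+3}$ has degree $d_\kappa$, and it has $d_\kappa$ real roots, which are simple and positive. Hence the solutions of the quantization condition $L_{d_\kappa}^{6\kappa+3}(2E)=0$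 are uniquely $E_{\kappa,1}<\dots<E_{\kappa,d_\kappa}$. 3. Each vector $|E_{\kappa,m},\kappa\rangle$ ($0\le\kappa\le\lfloor N/6\rfloor$, $1\le m\le d_\kappa$) is a nonzero eigenvector of $P_NH$ with eigenvalue $E_{\kappa,m}$. These vectors are mutually orthogonal, across families $\kappa$ and within each family, and for $E=E_{\kappa,m}$, $d=d_\kappa$, $$\langle E,\kappa|E,\kappa\rangle=e^{-2E}(2E)^{6\kappa}\,\frac16\,\frac1{24^{2\kappa}}\,\frac{d!}{(d+6\kappa+2)!}\;\mathcal L_{d-1}^{6\kappa+3}(2E)\,\mathcal L_{d-1}^{6\kappa+4}(2E).$$ 4. The matrix that expresses the vectors $|E_{\kappa,m},\kappa\rangle$ through the Fock states $|n,2\kappa\rangle$, $n<d_\kappa$, is $T=T_2T_1$. Here $T_1$ (from the Fock states to the states $\overline{|n,2\kappa\rangle}$) is triangular with unit diagonal in the lexicographic order of $(\kappa,n)$, so $\det T_1=1$. The matrix $T_2$ is block diagonal, its block $\kappa$ being the matrix $\big(L_n^{6\kappa+3}(2E_{\kappa,m})\big)_{m,n}$ with row $m$ multiplied by $(2E_{\kappa,m})^{3\kappa}e^{-E_{\kappa,m}}$,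 and $$\det\big(L_n^{6\kappa+3}(2E_{\kappa,m})\big)_{m,n}=\prod_{k=0}^{d_\kappa-1}\frac{(-1)^k}{k!\,(6\kappa+3+k)!}\prod_{1\le i<j\le d_\kappa}(2E_{\kappa,j}-2E_{\kappa,i})\neq0 .$$ Consequently $\det T\ne0$. The Fock states $|n,2\kappa\rangle$ ($0\le\kappa\le\lfloor N/6\rfloor$, $0\le n<d_\kappa$) are linearly independent, and the vectors $|E_{\kappa,m},\kappa\rangle$ form a basis of the even sector at cut-off $N$. -/

import Mathlib

open scoped Nat ComplexConjugate

noncomputable section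

namespace SYMQM

/-! ### Laguerre polynomials -/

/-- The generalized Laguerre polynomial `𝓛_n^a(x) = ∑ᵢ (-1)ⁱ (n+a choose n-i) xⁱ / i!`. -/
def laguerre (n a : ℕ) : Polynomial ℝ :=
  ∑ i ∈ Finset.range (n + 1),
    Polynomial.monomial i ((-1 : ℝ) ^ i * ((n + a).choose (n - i) : ℝ) / (i ! : ℝ))

/-- The rescaled (Sonine) polynomial `L_n^a(x) = 𝓛_n^a(x) / Γ(n+a+1)`, where `Γ(n+a+1) = (n+a)!`. -/
def sonine (n a : ℕ) (x : ℝ) : ℝ :=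
  (laguerre n a).eval x / ((n + a)! : ℝ)

/-! ### The bosonic Fock space of eight oscillators -/

/-- Bosonic states with finitely many quanta: polynomials in the eight commuting creation
operators, applied to the vacuum `|0⟩ = 1`. -/
abbrev Fock : Type := MvPolynomial (Fin 8) ℂ

/-- The Fock scalar product, conjugate linear in the first argument: monomials in the creation
operators are orthogonal and `‖∏ (a†_A)^{m_A} |0⟩‖² = ∏ m_A!`. -/
def fockInner (f g : Fock) : ℂ :=
  ∑ m ∈ f.support, ((∏ A, (m A)! : ℕ) : ℂ) * (conj (f.coeff m) * g.coeff m)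

/-- The creation operator `a†_A`. -/
def create (A : Fin 8) : Module.End ℂ Fock :=
  LinearMap.mulLeft ℂ (MvPolynomial.X A)

/-- The annihilation operator `a_A`, with `[a_A, a†_B] = δ_{AB}` and `a_A |0⟩ = 0`. -/
def annihilate (A : Fin 8) : Module.End ℂ Fock :=
  (MvPolynomial.pderiv A).toLinearMap

/-- `T` is a system of generators of `SU(3)` in the fundamental representation: eight Hermitian
traceless `3 × 3` matrices with `tr (T^A T^B) = δ_{AB} / 2`. -/
structure IsSU3Generators (T : Fin 8 → Matrix (Fin 3) (Fin 3) ℂ) : Prop where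
  isHermitian : ∀ A, (T A).IsHermitian
  trace_eq_zero : ∀ A, (T A).trace = 0
  trace_mul : ∀ A B, (T A * T B).trace = if A = B then 1 / 2 else 0

variable (T : Fin 8 → Matrix (Fin 3) (Fin 3) ℂ)

/-- The operator valued matrix `a†_{ij} = ∑_A a†_A T^A_{ij}`. -/
def createMatrix : Matrix (Fin 3) (Fin 3) (Module.End ℂ Fock) :=
  Matrix.of fun i j => ∑ A, T A i j • create A

/-- The operator valued matrix `a_{ij} = ∑_A a_A T^A_{ij}`. -/
def annihilateMatrix : Matrix (Fin 3) (Fin 3) (Module.End ℂ Fock) :=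
  Matrix.of fun i j => ∑ A, T A i j • annihilate A

/-- `H = tr(a†a) + 2 - tr(a†a†)/2 - tr(aa)/2`. -/
def hamiltonian : Module.End ℂ Fock :=
  (createMatrix T * annihilateMatrix T).trace + (2 : ℂ) • 1
    - (1 / 2 : ℂ) • (createMatrix T * createMatrix T).trace
    - (1 / 2 : ℂ) • (annihilateMatrix T * annihilateMatrix T).trace

/-- The projection onto the states with at most `N` quanta. -/
def cutProjection (N : ℕ) : Module.End ℂ Fock :=
  ∑ i ∈ Finset.range (N + 1), MvPolynomial.homogeneousComponent i

/-- The Hamiltonian at cut-off `N`, to be applied to states with at most `N` quanta. -/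
def cutHamiltonian (N : ℕ) : Module.End ℂ Fock :=
  cutProjection N * hamiltonian T

/-- The state `|j,k⟩ = (tr a†a†)^j (tr a†a†a†)^k |0⟩`. -/
def fockState (j k : ℕ) : Fock :=
  ((createMatrix T * createMatrix T).trace ^ j *
    (createMatrix T * createMatrix T * createMatrix T).trace ^ k) 1

/-- The span of the states `|j,2k⟩` with at most `N` quanta: the states at cut-off `N` that are
built with an even number of cubic bricks. -/
def evenSector (N : ℕ) : Submodule ℂ Fock :=
  Submodule.span ℂ {v | ∃ j k : ℕ, 2 * j + 3 * (2 * k) ≤ N ∧ v = fockState T j (2 * k)}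

/-! ### Orthogonalized Fock states and energy eigenstates -/

/-- `gammaEven κ t` is `(-24)^{t-κ} (κ+t)! / ((κ-t)! (2t)!)`, for `t ≤ κ`. -/
def gammaEven (κ t : ℕ) : ℝ :=
  (-24 : ℝ) ^ ((t : ℤ) - (κ : ℤ)) * ((κ + t)! : ℝ) / (((κ - t)! : ℝ) * ((2 * t)! : ℝ))

/-- The orthogonalized Fock state `|n,2κ⟩` with a bar. -/
def barState (n κ : ℕ) : Fock :=
  fockState T n (2 * κ) +
    ∑ t ∈ Finset.Icc 1 κ,
      ((gammaEven κ (κ - t) : ℝ) : ℂ) • fockState T (n + 3 * t) (2 * κ - 2 * t)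

/-- The number `d_κ = ⌊(N - 6κ)/2⌋ + 1` of states in the family `κ` at cut-off `N`, for
`6κ ≤ N`. -/
def dim (N κ : ℕ) : ℕ := (N - 6 * κ) / 2 + 1

/-- The vector `|e,κ⟩ = (2e)^{3κ} exp(-e) ∑_{n < d_κ} L_n^{6κ+3}(2e) |n,2κ⟩` (barred states on the
right). -/
def energyState (N κ : ℕ) (e : ℝ) : Fock :=
  (((2 * e) ^ (3 * κ) * Real.exp (-e) : ℝ) : ℂ) •
    ∑ n ∈ Finset.range (dim N κ), ((sonine n (6 * κ + 3) (2 * e) : ℝ) : ℂ) • barState T n κ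

/-- Labels `(κ, n)` with `κ ≤ ⌊N/6⌋` and `n < d_κ`; they label the Fock states `|n,2κ⟩` with at most
`N` quanta, the barred states, and the energy eigenstates at cut-off `N`. -/
abbrev Label (N : ℕ) : Type := Σ κ : Fin (N / 6 + 1), Fin (dim N κ)

/-- `E κ 0 < E κ 1 < …` are all the real solutions `e` of `L_{d_κ}^{6κ+3}(2e) = 0`, for each
family `κ`. -/
def IsEnergyLevels (N : ℕ) (E : (κ : Fin (N / 6 + 1)) → Fin (dim N κ) → ℝ) : Prop :=
  ∀ κ, StrictMono (E κ) ∧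
    Set.range (E κ) = {e : ℝ | sonine (dim N κ) (6 * (κ : ℕ) + 3) (2 * e) = 0}

/-! ### Transformation matrices -/

/-- The matrix from the Fock states to the barred states. -/
def matrixT₁ (N : ℕ) : Matrix (Label N) (Label N) ℝ :=
  Matrix.of fun i j =>
    if (j.1 : ℕ) ≤ (i.1 : ℕ) ∧ (j.2 : ℕ) = (i.2 : ℕ) + 3 * ((i.1 : ℕ) - (j.1 : ℕ)) then
      gammaEven i.1 j.1
    else 0

/-- The matrix with entries `L_n^{6κ+3}(2 E_m)`. -/
def laguerreMatrix {d : ℕ} (κ : ℕ) (E : Fin d → ℝ) : Matrix (Fin d) (Fin d) ℝ :=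
  Matrix.of fun m n => sonine n (6 * κ + 3) (2 * E m)

/-- The block diagonal matrix from the barred states to the energy eigenstates; each block is a
Laguerre matrix whose rows carry the normalization factors of the eigenstates. -/
def matrixT₂ (N : ℕ) (E : (κ : Fin (N / 6 + 1)) → Fin (dim N κ) → ℝ) :
    Matrix (Label N) (Label N) ℝ :=
  Matrix.blockDiagonal' fun κ =>
    Matrix.diagonal (fun m => (2 * E κ m) ^ (3 * (κ : ℕ)) * Real.exp (-(E κ m))) *
      laguerreMatrix κ (E κ)

end SYMQM

end

/-!
Put `ρ = ½ ∑ x_A²` (`halfNormSq`) and let `Δ` be half the Laplacian. On polynomials `tr a†a` is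
half the Euler operator, `tr a†a† = ρ` and `tr aa = Δ`, and `ρ`, `Δ` and the Euler operator span a
copy of `sl₂`.

The cubic invariant `c = tr a†a†a†` is harmonic and `|∇c|² = ¾ ρ²` (from completeness of the
generators and Cayley–Hamilton), so the three-term recursion `h_{k+2} = c h_{k+1} - ρ³ h_k / 24`
produces harmonic polynomials. The barred states are `ρⁿ h_{2κ}`: powers of `ρ` times harmonic
polynomials of different degrees are orthogonal, and the `sl₂` relations give their norms.

On `∑ s_n ρⁿ h` with `h` harmonic of degree `e`, the equation `H v = E v` is the three-term
recurrence of `L_n^{e+3}(2E)`. Truncation by the cut-off leaves a single boundary term,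
proportional to `L_d^{e+3}(2E)`, whence the quantization condition. The Christoffel–Darboux formula
for this recurrence gives real and simple roots, orthogonality within a family, and the norms.
Finally `T₁` is unitriangular, and the blocks of `T₂` are Vandermonde matrices up to a triangular
change of polynomial basis.
-/

noncomputable section

namespace SYMQM

section Laguerre

open Polynomial

theorem cast_choose_mul_succ {R : Type*} [CommRing R] (m k : ℕ) :
    (m.choose k : R) * (m + 1) = (m + 1).choose k * (m + 1 - k) := by
  rcases le_or_gt k (m + 1) with h | h
  · have := congrArg (Nat.cast (R := R)) (Nat.choose_mul_succ_eq m k)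
    simpa only [Nat.cast_mul, Nat.cast_sub h, Nat.cast_succ] using this
  · simp only [Nat.choose_eq_zero_of_lt h, Nat.choose_eq_zero_of_lt (Nat.lt_of_succ_lt h),
      Nat.cast_zero, zero_mul]

theorem cast_choose_succ_mul_succ {R : Type*} [CommRing R] (m k : ℕ) :
    (m.choose (k + 1) : R) * (k + 1) = m.choose k * (m - k) := by
  rcases le_or_gt k m with h | h
  · have := congrArg (Nat.cast (R := R)) (Nat.choose_succ_right_eq m k)
    simpa only [Nat.cast_mul, Nat.cast_sub h, Nat.cast_succ] using this
  · simp only [Nat.choose_eq_zero_of_lt h, Nat.choose_eq_zero_of_lt (h.trans k.lt_succ_self),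
      Nat.cast_zero, zero_mul]

theorem coeff_laguerre (n a i : ℕ) :
    (laguerre n a).coeff i = (-1 : ℝ) ^ i * ((n + a).choose (a + i) : ℝ) / (i ! : ℝ) := by
  rw [laguerre, finsetSum_coeff]
  simp only [coeff_monomial, Finset.sum_ite_eq', Finset.mem_range]
  split_ifs with h
  · rw [← Nat.choose_symm (n := n + a) (k := n - i) (by omega)]
    congr 4
    omega
  · rw [Nat.choose_eq_zero_of_lt (by omega), Nat.cast_zero, mul_zero, zero_div]

theorem coeff_laguerre_self (n a : ℕ) : (laguerre n a).coeff n = (-1 : ℝ) ^ n / (n ! : ℝ) := by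
  rw [coeff_laguerre, add_comm a n, Nat.choose_self, Nat.cast_one, mul_one]

theorem natDegree_laguerre (n a : ℕ) : (laguerre n a).natDegree = n := by
  refine le_antisymm (natDegree_le_iff_coeff_eq_zero.2 fun i hi => ?_)
    (le_natDegree_of_ne_zero ?_)
  · rw [coeff_laguerre, Nat.choose_eq_zero_of_lt (by omega), Nat.cast_zero, mul_zero, zero_div]
  · rw [coeff_laguerre_self]
    positivity

theorem laguerre_ne_zero (n a : ℕ) : laguerre n a ≠ 0 := fun h => by
  have hcoeff : (laguerre n a).coeff n ≠ 0 := by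
    rw [coeff_laguerre_self]
    positivity
  exact hcoeff (by rw [h, coeff_zero])

theorem laguerre_zero (a : ℕ) : laguerre 0 a = 1 := by
  simp [laguerre]

theorem laguerre_one (a : ℕ) : laguerre 1 a = (a + 1 : ℝ[X]) - X := by
  simp [laguerre, Finset.sum_range_succ, ← C_mul_X_eq_monomial, sub_eq_add_neg, add_comm 1]

theorem laguerre_recurrence (n a : ℕ) :
    (n + 2 : ℝ[X]) * laguerre (n + 2) a =
      ((2 * n + a + 3 : ℝ[X]) - X) * laguerre (n + 1) a - (n + 1 + a : ℝ[X]) * laguerre n a := by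
  have hC₂ : (n + 2 : ℝ[X]) = C (n + 2 : ℝ) := by
    simp only [map_add, map_natCast, map_ofNat]
  have hC₁ : (2 * n + a + 3 : ℝ[X]) = C (2 * n + a + 3 : ℝ) := by
    simp only [map_add, map_mul, map_natCast, map_ofNat]
  have hC₀ : (n + 1 + a : ℝ[X]) = C (n + 1 + a : ℝ) := by
    simp only [map_add, map_natCast, map_one]
  rw [hC₂, hC₁, hC₀, sub_mul]
  ext i
  rcases i with _ | i
  · simp only [coeff_sub, coeff_C_mul, coeff_X_mul_zero, coeff_laguerre, pow_zero,
      Nat.factorial_zero, Nat.cast_one, add_zero, div_one, one_mul]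
    have hup₀ := cast_choose_mul_succ (R := ℝ) (n + a) a
    have hup₁ := cast_choose_mul_succ (R := ℝ) (n + a + 1) a
    rw [show n + 2 + a = n + a + 1 + 1 by ring, show n + 1 + a = n + a + 1 by ring]
    push_cast at hup₀ hup₁ ⊢
    linear_combination hup₀ - hup₁
  · simp only [coeff_sub, coeff_C_mul, coeff_X_mul, coeff_laguerre, Nat.factorial_succ]
    have hup := cast_choose_mul_succ (R := ℝ) (n + a) (a + i + 1)
    have hright := cast_choose_succ_mul_succ (R := ℝ) (n + a + 1) (a + i)
    have hpascal : ((n + a + 2).choose (a + i + 1) : ℝ) =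
        (n + a + 1).choose (a + i) + (n + a + 1).choose (a + i + 1) := by
      exact_mod_cast Nat.choose_succ_succ (n + a + 1) (a + i)
    rw [show n + 2 + a = n + a + 2 by ring, show n + 1 + a = n + a + 1 by ring,
      ← add_assoc a i 1, hpascal]
    push_cast at hup hright ⊢
    field_simp
    linear_combination (-1) ^ i * hright - (-1) ^ i * hup

theorem derivative_laguerre (n a : ℕ) :
    derivative (laguerre (n + 1) a) = -laguerre n (a + 1) := by
  ext i
  rw [coeff_derivative, coeff_neg, coeff_laguerre, coeff_laguerre, Nat.factorial_succ,
    show n + 1 + a = n + (a + 1) by ring, show a + (i + 1) = a + 1 + i by ring]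
  push_cast
  field_simp
  ring

theorem eval_laguerre_pos (n a : ℕ) {x : ℝ} (hx : x ≤ 0) : 0 < (laguerre n a).eval x := by
  have hterm : ∀ i : ℕ, (-1 : ℝ) ^ i * ((n + a).choose (n - i) : ℝ) / (i ! : ℝ) * x ^ i =
      ((n + a).choose (n - i) : ℝ) / (i ! : ℝ) * (-x) ^ i := fun i => by
    rw [neg_pow x]
    ring
  have hx' : 0 ≤ -x := neg_nonneg.2 hx
  have hchoose : 0 < (n + a).choose n := Nat.choose_pos (Nat.le_add_right n a)
  rw [laguerre, eval_finsetSum]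
  simp only [eval_monomial, hterm]
  rw [Finset.sum_range_succ', Nat.sub_zero]
  positivity

end Laguerre

section SonineSequences

/-- `s` solves, at the point `x`, the three-term recurrence of the rescaled Laguerre polynomials
`n ↦ L_n^a(x)`. The recurrence is cleared of denominators, so that it makes sense over every
commutative ring; `s 0` is left free. -/
structure IsSonineSeq {R : Type*} [CommRing R] (a : ℕ) (x : R) (s : ℕ → R) : Prop where
  one : (a + 1) * s 1 = (a + 1 - x) * s 0
  add_two : ∀ n : ℕ, (n + 2) * (n + a + 2) * s (n + 2) = (2 * n + a + 3 - x) * s (n + 1) - s n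

theorem isSonineSeq_aeval {K : Type*} [Field K] [CharZero K] [Algebra ℝ K] (a : ℕ) (x : K) :
    IsSonineSeq a x fun n => Polynomial.aeval x (laguerre n a) / ((n + a)! : K) where
  one := by
    have ha : (a + 1 : K) ≠ 0 := Nat.cast_add_one_ne_zero a
    have ha' : (a ! : K) ≠ 0 := Nat.cast_ne_zero.2 a.factorial_ne_zero
    rw [laguerre_one, laguerre_zero, zero_add, add_comm 1 a, Nat.factorial_succ]
    simp only [Nat.cast_mul, Nat.cast_succ, map_sub, map_add, map_natCast, map_one,
      Polynomial.aeval_X]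
    field_simp
  add_two n := by
    have h₁ : (n + a + 1 : K) ≠ 0 := by exact_mod_cast Nat.succ_ne_zero (n + a)
    have h₂ : (n + a + 2 : K) ≠ 0 := by exact_mod_cast Nat.succ_ne_zero (n + a + 1)
    have hfact : ((n + a)! : K) ≠ 0 := Nat.cast_ne_zero.2 (n + a).factorial_ne_zero
    have hrec := congrArg (Polynomial.aeval x) (laguerre_recurrence n a)
    simp only [map_mul, map_sub, map_add, map_natCast, map_ofNat, map_one,
      Polynomial.aeval_X] at hrec
    rw [show n + 2 + a = n + a + 1 + 1 by ring, show n + 1 + a = n + a + 1 by ring,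
      Nat.factorial_succ, Nat.factorial_succ]
    push_cast
    rw [show (n + a + 1 + 1 : K) = n + a + 2 by ring]
    field_simp
    linear_combination hrec

theorem isSonineSeq_sonine (a : ℕ) (x : ℝ) : IsSonineSeq a x fun n => sonine n a x := by
  simpa only [sonine, Polynomial.coe_aeval_eq_eval] using isSonineSeq_aeval (K := ℝ) a x

namespace IsSonineSeq

variable {R S : Type*} [CommRing R] [CommRing S] {a : ℕ} {x y : R} {s t : ℕ → R}

theorem map (f : R →+* S) (hs : IsSonineSeq a x s) : IsSonineSeq a (f x) fun n => f (s n) where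
  one := by simpa only [map_mul, map_add, map_sub, map_natCast, map_one] using congrArg f hs.one
  add_two n := by
    simpa only [map_mul, map_add, map_sub, map_natCast, map_ofNat] using congrArg f (hs.add_two n)

theorem christoffel_darboux (hs : IsSonineSeq a x s) (ht : IsSonineSeq a y t) (d : ℕ) :
    (x - y) * ∑ n ∈ Finset.range (d + 1), (n ! : R) * (n + a)! * (s n * t n) =
      ((d + 1)! : R) * (d + a + 1)! * (s d * t (d + 1) - s (d + 1) * t d) := by
  induction d with
  | zero =>
    simp only [Finset.range_one, Finset.sum_singleton, zero_add, Nat.factorial_succ,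
      Nat.factorial_zero]
    push_cast
    linear_combination (a ! : R) * t 0 * hs.one - (a ! : R) * s 0 * ht.one
  | succ d ih =>
    rw [Finset.sum_range_succ, mul_add, ih, Nat.factorial_succ (d + 1),
      show d + 1 + a + 1 = (d + a + 1) + 1 by ring, Nat.factorial_succ (d + a + 1),
      show d + 1 + a = d + a + 1 by ring]
    push_cast
    linear_combination ((d + 1)! : R) * (d + a + 1)! *
      (t (d + 1) * hs.add_two d - s (d + 1) * ht.add_two d)

end IsSonineSeq

theorem sum_factorial_mul_norm_sq_pos {V : Type*} [NormedAddCommGroup V] (a : ℕ) {s : ℕ → V}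
    (h₀ : s 0 ≠ 0) (d : ℕ) :
    0 < ∑ n ∈ Finset.range (d + 1), (n ! : ℝ) * (n + a)! * ‖s n‖ ^ 2 := by
  have : 0 < ‖s 0‖ := norm_pos_iff.2 h₀
  rw [Finset.sum_range_succ']
  positivity

/-- Christoffel–Darboux for `s` and its conjugate turns a zero into
`(x - conj x) * positive = 0`. -/
theorem IsSonineSeq.conj_eq_of_eq_zero {𝕜 : Type*} [RCLike 𝕜] {a : ℕ} {x : 𝕜} {s : ℕ → 𝕜}
    (hs : IsSonineSeq a x s) (h₀ : s 0 ≠ 0) {d : ℕ} (hd : s (d + 1) = 0) : conj x = x := by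
  have hcd := hs.christoffel_darboux (hs.map (starRingEnd 𝕜)) d
  have hsum : ∑ n ∈ Finset.range (d + 1), (n ! : 𝕜) * (n + a)! * (s n * conj (s n)) =
      ((∑ n ∈ Finset.range (d + 1), (n ! : ℝ) * (n + a)! * ‖s n‖ ^ 2 : ℝ) : 𝕜) := by
    push_cast
    simp only [RCLike.mul_conj]
  rw [hsum, hd, map_zero, mul_zero, zero_mul, sub_zero, mul_zero, mul_eq_zero,
    RCLike.ofReal_eq_zero, or_iff_left (sum_factorial_mul_norm_sq_pos a h₀ d).ne',
    sub_eq_zero] at hcd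
  exact hcd.symm

end SonineSequences

section LaguerreRoots

open Polynomial

theorem sonine_eq_zero_iff {n a : ℕ} {x : ℝ} : sonine n a x = 0 ↔ (laguerre n a).IsRoot x := by
  rw [sonine, div_eq_zero_iff, or_iff_left (by positivity), IsRoot]

theorem sonine_zero_ne_zero (a : ℕ) (x : ℝ) : sonine 0 a x ≠ 0 := by
  rw [Ne, sonine_eq_zero_iff, laguerre_zero, IsRoot, eval_one]
  exact one_ne_zero

theorem sum_sonine_sq_pos (a : ℕ) (x : ℝ) (d : ℕ) :
    0 < ∑ n ∈ Finset.range (d + 1), (n ! : ℝ) * (n + a)! * sonine n a x ^ 2 := by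
  simpa only [Real.norm_eq_abs, sq_abs] using
    sum_factorial_mul_norm_sq_pos a (s := fun n => sonine n a x) (sonine_zero_ne_zero a x) d

theorem sum_sonine_sq (a : ℕ) (x : ℝ) (d : ℕ) :
    ∑ n ∈ Finset.range (d + 1), (n ! : ℝ) * (n + a)! * sonine n a x ^ 2 =
      ((d + 1)! : ℝ) / (d + a)! *
        ((derivative (laguerre d a)).eval x * (laguerre (d + 1) a).eval x
          - (derivative (laguerre (d + 1) a)).eval x * (laguerre d a).eval x) := by
  simp only [sonine]
  induction d with
  | zero =>
    simp only [zero_add, Finset.sum_range_one, laguerre_zero, laguerre_one, derivative_one,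
      derivative_sub, derivative_add, derivative_natCast, derivative_X, eval_sub, eval_add,
      eval_natCast, eval_X, eval_one, eval_zero, Nat.factorial_zero, Nat.factorial_one,
      Nat.cast_one]
    field_simp
    ring
  | succ d ih =>
    have hrec := congrArg (eval x) (laguerre_recurrence d a)
    have hrec' := congrArg (fun p => eval x (derivative p)) (laguerre_recurrence d a)
    simp only [eval_mul, eval_sub, eval_add, eval_natCast, eval_ofNat, eval_one, eval_X,
      derivative_mul, derivative_sub, derivative_add, derivative_natCast, derivative_ofNat,
      derivative_one, derivative_X, eval_zero] at hrec hrec'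
    rw [Finset.sum_range_succ, ih, Nat.factorial_succ (d + 1), show d + 1 + 1 = d + 2 by ring,
      show d + 1 + a = (d + a) + 1 by ring, Nat.factorial_succ (d + a)]
    push_cast
    field_simp
    linear_combination (-eval x (derivative (laguerre (d + 1) a))) * hrec +
      eval x (laguerre (d + 1) a) * hrec'

theorem sum_sonine_sq_of_isRoot {d a : ℕ} {x : ℝ} (hx : (laguerre (d + 1) a).IsRoot x) :
    ∑ n ∈ Finset.range (d + 1), (n ! : ℝ) * (n + a)! * sonine n a x ^ 2 =
      ((d + 1)! : ℝ) / (d + a)! * ((laguerre d a).eval x * (laguerre d (a + 1)).eval x) := by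
  rw [sum_sonine_sq, derivative_laguerre, hx.eq_zero, eval_neg]
  ring

theorem splits_laguerre (n a : ℕ) : (laguerre n a).Splits := by
  rcases n with _ | d
  · rw [laguerre_zero]
    exact Splits.one
  refine Splits.of_splits_map (algebraMap ℝ ℂ) (IsAlgClosed.splits _) fun z hz => ?_
  have hz_root : aeval z (laguerre (d + 1) a) = 0 := by
    rw [aeval_def, ← eval_map]
    exact (mem_roots'.1 hz).2
  have hz_real : conj z = z := (isSonineSeq_aeval a z).conj_eq_of_eq_zero (d := d)
    (by simp [laguerre_zero, Nat.factorial_ne_zero]) (by rw [hz_root, zero_div])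
  exact ⟨z.re, Complex.conj_eq_iff_re.1 hz_real⟩

theorem card_roots_laguerre (n a : ℕ) : (laguerre n a).roots.card = n := by
  rw [← (splits_laguerre n a).natDegree_eq_card_roots, natDegree_laguerre]

theorem nodup_roots_laguerre (n a : ℕ) : (laguerre n a).roots.Nodup := by
  rcases n with _ | d
  · rw [laguerre_zero, roots_one]
    exact Multiset.nodup_zero
  refine Multiset.nodup_iff_count_le_one.2 fun x => ?_
  rw [count_roots]
  by_contra! hmult
  obtain ⟨hroot, hroot'⟩ :=
    (one_lt_rootMultiplicity_iff_isRoot (laguerre_ne_zero (d + 1) a)).1 hmult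
  refine (sum_sonine_sq_pos a x d).ne' ?_
  rw [sum_sonine_sq, hroot.eq_zero, hroot'.eq_zero, mul_zero, zero_mul, sub_zero, mul_zero]

theorem pos_of_mem_roots_laguerre {n a : ℕ} {x : ℝ} (hx : x ∈ (laguerre n a).roots) : 0 < x := by
  by_contra! hx'
  exact (eval_laguerre_pos n a hx').ne' (isRoot_of_mem_roots hx)

end LaguerreRoots

section LaguerreDeterminant

open Polynomial

theorem det_eval_of_natDegree_le {R : Type*} [CommRing R] {d : ℕ} (v : Fin d → R)
    (p : Fin d → R[X]) (hp : ∀ i, (p i).natDegree ≤ i) :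
    (Matrix.of fun i j => (p j).eval (v i)).det =
      (∏ i, (p i).coeff i) * ∏ i, ∏ j ∈ Finset.Ioi i, (v j - v i) := by
  rw [Matrix.eval_matrixOfPolynomials_eq_vandermonde_mul_matrixOfPolynomials v p hp,
    Matrix.det_mul, Matrix.det_vandermonde, mul_comm, Matrix.det_of_isUpperTriangular]
  · rfl
  · intro i j hji
    exact coeff_eq_zero_of_natDegree_lt ((hp j).trans_lt hji)

theorem det_laguerreMatrix {d : ℕ} (κ : ℕ) (E : Fin d → ℝ) :
    (laguerreMatrix κ E).det =
      (∏ k : Fin d, (-1 : ℝ) ^ (k : ℕ) /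
        (((k : ℕ)! : ℝ) * ((6 * κ + 3 + (k : ℕ))! : ℝ))) *
        ∏ i : Fin d, ∏ j ∈ Finset.Ioi i, (2 * E j - 2 * E i) := by
  have heval : laguerreMatrix κ E = Matrix.of fun m n : Fin d =>
      (C ((n + (6 * κ + 3))! : ℝ)⁻¹ * laguerre n (6 * κ + 3)).eval (2 * E m) := by
    ext m n
    simp only [laguerreMatrix, sonine, div_eq_inv_mul, Matrix.of_apply, eval_mul, eval_C]
  rw [heval, det_eval_of_natDegree_le (fun m => 2 * E m) _ fun n =>
    (natDegree_C_mul_le _ _).trans (natDegree_laguerre _ _).le]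
  congr 1
  refine Finset.prod_congr rfl fun k _ => ?_
  rw [coeff_C_mul, coeff_laguerre_self, add_comm (6 * κ + 3) (k : ℕ)]
  field_simp

theorem det_laguerreMatrix_ne_zero {d : ℕ} (κ : ℕ) {E : Fin d → ℝ} (hE : StrictMono E) :
    (laguerreMatrix κ E).det ≠ 0 := by
  rw [det_laguerreMatrix]
  refine mul_ne_zero (Finset.prod_ne_zero_iff.2 fun k _ => by positivity)
    (Finset.prod_ne_zero_iff.2 fun i _ => Finset.prod_ne_zero_iff.2 fun j hj => ?_)
  have := hE (Finset.mem_Ioi.1 hj)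
  linarith

end LaguerreDeterminant

section Laplacian

open MvPolynomial

variable {σ : Type*} [Fintype σ]

/-- The scalar product `∇f · ∇g` of the gradients of two polynomials. -/
def gradInner {R : Type*} [CommSemiring R] (f g : MvPolynomial σ R) : MvPolynomial σ R :=
  ∑ i, pderiv i f * pderiv i g

section CommRing

variable {R : Type*} [CommRing R]

theorem gradInner_comm (f g : MvPolynomial σ R) : gradInner f g = gradInner g f := by
  simp only [gradInner, mul_comm]

theorem gradInner_sub_right (f g h : MvPolynomial σ R) :
    gradInner f (g - h) = gradInner f g - gradInner f h := by
  simp only [gradInner, map_sub, mul_sub, Finset.sum_sub_distrib]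

theorem gradInner_smul_right (c : R) (f g : MvPolynomial σ R) :
    gradInner f (c • g) = c • gradInner f g := by
  simp only [gradInner, Derivation.map_smul, mul_smul_comm, Finset.smul_sum]

theorem gradInner_one_right (f : MvPolynomial σ R) : gradInner f 1 = 0 := by
  simp only [gradInner, pderiv_one, mul_zero, Finset.sum_const_zero]

theorem gradInner_mul_right (f g h : MvPolynomial σ R) :
    gradInner f (g * h) = gradInner f g * h + g * gradInner f h := by
  simp only [gradInner, pderiv_mul, Finset.sum_mul, Finset.mul_sum, ← Finset.sum_add_distrib]
  exact Finset.sum_congr rfl fun i _ => by ring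

theorem gradInner_X_left (i : σ) (f : MvPolynomial σ R) : gradInner (X i) f = pderiv i f := by
  classical
  simp only [gradInner, pderiv_X, Pi.single_apply, ite_mul, one_mul, zero_mul,
    Finset.sum_ite_eq, Finset.mem_univ, if_true]

omit [Fintype σ] in
theorem pderiv_comm (i j : σ) (f : MvPolynomial σ R) :
    pderiv i (pderiv j f) = pderiv j (pderiv i f) := by
  classical
  have hcomm : ⁅pderiv (R := R) i, pderiv (R := R) j⁆ = 0 := by
    refine derivation_ext fun k => ?_
    rw [Derivation.commutator_apply, pderiv_X, pderiv_X, Pi.single_apply, Pi.single_apply]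
    split_ifs <;> simp
  exact sub_eq_zero.1 (congrArg (fun D => D f) hcomm)

end CommRing

variable {K : Type*} [Field K]

/-- Half of the Laplace operator, `½ ∑ ∂ᵢ²`. -/
def halfLaplacian : Module.End K (MvPolynomial σ K) :=
  (1 / 2 : K) • ∑ i, (pderiv i).toLinearMap ∘ₗ (pderiv i).toLinearMap

/-- Half of the squared norm of the coordinate vector, `½ ∑ xᵢ²`. -/
def halfNormSq : MvPolynomial σ K :=
  (1 / 2 : K) • ∑ i, X i ^ 2

theorem halfLaplacian_apply (f : MvPolynomial σ K) :
    halfLaplacian f = (1 / 2 : K) • ∑ i, pderiv i (pderiv i f) := by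
  simp only [halfLaplacian, LinearMap.smul_apply, LinearMap.sum_apply]
  rfl

theorem halfLaplacian_one : halfLaplacian (1 : MvPolynomial σ K) = 0 := by
  simp only [halfLaplacian_apply, pderiv_one, map_zero, Finset.sum_const_zero, smul_zero]

theorem halfLaplacian_X (i : σ) : halfLaplacian (X i : MvPolynomial σ K) = 0 := by
  classical
  rw [halfLaplacian_apply, Finset.sum_eq_zero fun j _ => ?_, smul_zero]
  rw [pderiv_X, Pi.single_apply]
  split_ifs
  · exact pderiv_one
  · exact map_zero _

theorem halfLaplacian_pderiv (i : σ) (f : MvPolynomial σ K) :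
    halfLaplacian (pderiv i f) = pderiv i (halfLaplacian f) := by
  simp only [halfLaplacian_apply, map_sum, Derivation.map_smul, pderiv_comm _ i]

theorem isHomogeneous_halfNormSq : (halfNormSq : MvPolynomial σ K).IsHomogeneous 2 := by
  rw [halfNormSq, smul_eq_C_mul]
  simpa only [zero_add] using (isHomogeneous_C _ _).mul
    (IsHomogeneous.sum _ _ _ fun i _ => isHomogeneous_X_pow i 2)

theorem isHomogeneous_halfNormSq_pow_mul {f : MvPolynomial σ K} {e : ℕ} (hf : f.IsHomogeneous e)
    (n : ℕ) : (halfNormSq ^ n * f).IsHomogeneous (2 * n + e) :=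
  (isHomogeneous_halfNormSq.pow n).mul hf

variable [CharZero K]

theorem halfLaplacian_mul (f g : MvPolynomial σ K) :
    halfLaplacian (f * g) = f * halfLaplacian g + halfLaplacian f * g + gradInner f g := by
  have hleibniz : ∀ i : σ, pderiv i (pderiv i (f * g)) = f * pderiv i (pderiv i g) +
      pderiv i (pderiv i f) * g + (2 : K) • (pderiv i f * pderiv i g) := fun i => by
    simp only [pderiv_mul, map_add, two_smul]
    ring
  simp only [halfLaplacian_apply, hleibniz, Finset.sum_add_distrib, ← Finset.mul_sum,
    ← Finset.sum_mul, ← Finset.smul_sum, gradInner, smul_add, smul_smul, mul_smul_comm,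
    smul_mul_assoc]
  rw [one_div, inv_mul_cancel₀ two_ne_zero, one_smul]

theorem halfLaplacian_X_mul (i : σ) (f : MvPolynomial σ K) :
    halfLaplacian (X i * f) = X i * halfLaplacian f + pderiv i f := by
  rw [halfLaplacian_mul, halfLaplacian_X, gradInner_X_left, zero_mul, add_zero]

theorem halfLaplacian_X_mul_X_mul_X_mul {f : MvPolynomial σ K} (hf : halfLaplacian f = 0)
    (i j k : σ) :
    halfLaplacian (halfLaplacian (halfLaplacian (X i * (X j * (X k * f))))) =
      (6 : K) • pderiv i (pderiv j (pderiv k f)) := by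
  simp only [halfLaplacian_X_mul, map_add, halfLaplacian_pderiv, hf, map_zero, mul_zero, zero_add,
    add_zero]
  module

theorem pderiv_halfNormSq (i : σ) : pderiv i (halfNormSq : MvPolynomial σ K) = X i := by
  classical
  simp only [halfNormSq, Derivation.map_smul, map_sum, sq, pderiv_mul, pderiv_X, Pi.single_apply,
    ite_mul, mul_ite, one_mul, mul_one, zero_mul, mul_zero, Finset.sum_add_distrib,
    Finset.sum_ite_eq', Finset.mem_univ, if_true]
  module

theorem gradInner_halfNormSq_left {f : MvPolynomial σ K} {e : ℕ} (hf : f.IsHomogeneous e) :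
    gradInner halfNormSq f = (e : K) • f := by
  simp only [gradInner, pderiv_halfNormSq, hf.sum_X_mul_pderiv, Nat.cast_smul_eq_nsmul]

theorem halfLaplacian_halfNormSq :
    halfLaplacian (halfNormSq : MvPolynomial σ K) = (Fintype.card σ / 2 : K) • 1 := by
  simp only [halfLaplacian_apply, pderiv_halfNormSq, pderiv_X_self, Finset.sum_const,
    Finset.card_univ]
  module

theorem halfLaplacian_halfNormSq_mul {f : MvPolynomial σ K} {e : ℕ} (hf : f.IsHomogeneous e) :
    halfLaplacian (halfNormSq * f) =
      halfNormSq * halfLaplacian f + (e + Fintype.card σ / 2 : K) • f := by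
  rw [halfLaplacian_mul, halfLaplacian_halfNormSq, gradInner_halfNormSq_left hf, smul_mul_assoc,
    one_mul]
  module

theorem halfLaplacian_halfNormSq_pow_succ_mul {f : MvPolynomial σ K} {e : ℕ}
    (hf : f.IsHomogeneous e) (hf₀ : halfLaplacian f = 0) (n : ℕ) :
    halfLaplacian (halfNormSq ^ (n + 1) * f) =
      ((n + 1) * (n + e + Fintype.card σ / 2) : K) • (halfNormSq ^ n * f) := by
  induction n with
  | zero =>
    rw [zero_add, pow_one, halfLaplacian_halfNormSq_mul hf, hf₀, mul_zero, zero_add, pow_zero,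
      one_mul]
    push_cast
    module
  | succ n ih =>
    rw [pow_succ' _ (n + 1), mul_assoc,
      halfLaplacian_halfNormSq_mul (isHomogeneous_halfNormSq_pow_mul hf (n + 1)), ih,
      mul_smul_comm, ← mul_assoc, ← pow_succ']
    push_cast
    module

end Laplacian

section FockScalarProduct

theorem fockInner_eq_sum {f : Fock} {s : Finset (Fin 8 →₀ ℕ)} (hs : f.support ⊆ s) (g : Fock) :
    fockInner f g = ∑ m ∈ s, ((∏ A, (m A)! : ℕ) : ℂ) * (conj (f.coeff m) * g.coeff m) := by
  refine Finset.sum_subset hs fun m _ hm => ?_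
  rw [MvPolynomial.notMem_support_iff.1 hm, map_zero, zero_mul, mul_zero]

theorem fockInner_add_left (f f' g : Fock) :
    fockInner (f + f') g = fockInner f g + fockInner f' g := by
  classical
  rw [fockInner_eq_sum MvPolynomial.support_add g,
    fockInner_eq_sum (Finset.subset_union_left (s₂ := f'.support)) g,
    fockInner_eq_sum (Finset.subset_union_right (s₁ := f.support)) g, ← Finset.sum_add_distrib]
  refine Finset.sum_congr rfl fun m _ => ?_
  rw [MvPolynomial.coeff_add, map_add]
  ring

theorem fockInner_smul_left (c : ℂ) (f g : Fock) :
    fockInner (c • f) g = conj c * fockInner f g := by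
  rw [fockInner_eq_sum MvPolynomial.support_smul g, fockInner, Finset.mul_sum]
  refine Finset.sum_congr rfl fun m _ => ?_
  rw [MvPolynomial.coeff_smul, smul_eq_mul, map_mul]
  ring

theorem fockInner_add_right (f g g' : Fock) :
    fockInner f (g + g') = fockInner f g + fockInner f g' := by
  simp only [fockInner, ← Finset.sum_add_distrib, MvPolynomial.coeff_add, mul_add]

theorem fockInner_smul_right (c : ℂ) (f g : Fock) :
    fockInner f (c • g) = c * fockInner f g := by
  rw [fockInner, fockInner, Finset.mul_sum]
  refine Finset.sum_congr rfl fun m _ => ?_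
  rw [MvPolynomial.coeff_smul, smul_eq_mul]
  ring

/-- The Fock scalar product as a sesquilinear form, so that linear algebra over forms applies. -/
def fockForm : Fock →ₗ⋆[ℂ] Fock →ₗ[ℂ] ℂ :=
  LinearMap.mk₂'ₛₗ (starRingEnd ℂ) (RingHom.id ℂ) fockInner fockInner_add_left
    fockInner_smul_left fockInner_add_right fockInner_smul_right

theorem fockForm_apply (f g : Fock) : fockForm f g = fockInner f g := rfl

theorem fockInner_sum_left {ι : Type*} (s : Finset ι) (f : ι → Fock) (g : Fock) :
    fockInner (∑ i ∈ s, f i) g = ∑ i ∈ s, fockInner (f i) g := by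
  simp only [← fockForm_apply, map_sum, LinearMap.sum_apply]

theorem fockInner_sum_right {ι : Type*} (s : Finset ι) (f : Fock) (g : ι → Fock) :
    fockInner f (∑ i ∈ s, g i) = ∑ i ∈ s, fockInner f (g i) := by
  simp only [← fockForm_apply, map_sum]

theorem fockInner_sub_left (f f' g : Fock) :
    fockInner (f - f') g = fockInner f g - fockInner f' g := by
  simp only [← fockForm_apply, map_sub, LinearMap.sub_apply]

theorem fockInner_zero_right (f : Fock) : fockInner f 0 = 0 := by
  rw [← fockForm_apply, map_zero]

theorem conj_fockInner (f g : Fock) : conj (fockInner f g) = fockInner g f := by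
  classical
  rw [fockInner_eq_sum (Finset.subset_union_left (s₂ := g.support)) g,
    fockInner_eq_sum (Finset.subset_union_right (s₁ := f.support)) f, map_sum]
  refine Finset.sum_congr rfl fun m _ => ?_
  rw [map_mul, map_mul, Complex.conj_conj, Complex.conj_natCast]
  ring

theorem fockInner_one_one : fockInner 1 1 = 1 := by
  classical
  rw [fockInner_eq_sum (s := {0})]
  · simp
  · rw [← MvPolynomial.C_1]
    exact MvPolynomial.support_monomial_subset

theorem fockInner_sum_smul_sum_smul_of_pairwise {ι : Type*} {v : ι → Fock}
    (hv : Pairwise fun i j => fockInner (v i) (v j) = 0) (s : Finset ι) (a b : ι → ℂ) :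
    fockInner (∑ i ∈ s, a i • v i) (∑ i ∈ s, b i • v i) =
      ∑ i ∈ s, conj (a i) * b i * fockInner (v i) (v i) := by
  rw [fockInner_sum_left]
  refine Finset.sum_congr rfl fun i hi => ?_
  rw [fockInner_sum_right, Finset.sum_eq_single_of_mem i hi fun j _ hj => ?_]
  · rw [fockInner_smul_left, fockInner_smul_right, mul_assoc]
  · rw [fockInner_smul_left, fockInner_smul_right, hv hj.symm, mul_zero, mul_zero]

theorem prod_factorial_single_add {ι : Type*} [Fintype ι] (i : ι) (m : ι →₀ ℕ) :
    ∏ j, ((Finsupp.single i 1 + m : ι →₀ ℕ) j)! = (m i + 1) * ∏ j, (m j)! := by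
  classical
  rw [← Finset.mul_prod_erase _ _ (Finset.mem_univ i),
    ← Finset.mul_prod_erase _ (fun j => (m j)!) (Finset.mem_univ i), ← mul_assoc,
    Finsupp.add_apply, Finsupp.single_eq_same, add_comm 1, Nat.factorial_succ]
  congr 1
  refine Finset.prod_congr rfl fun j hj => ?_
  rw [Finsupp.add_apply, Finsupp.single_eq_of_ne (Finset.ne_of_mem_erase hj), zero_add]

theorem fockInner_X_mul (A : Fin 8) (f g : Fock) :
    fockInner (MvPolynomial.X A * f) g = fockInner f (MvPolynomial.pderiv A g) := by
  rw [fockInner, MvPolynomial.support_X_mul, Finset.sum_map, fockInner]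
  refine Finset.sum_congr rfl fun m _ => ?_
  rw [addLeftEmbedding_apply, MvPolynomial.coeff_X_mul, MvPolynomial.coeff_pderiv,
    prod_factorial_single_add, add_comm m]
  push_cast
  ring

theorem fockInner_halfNormSq_mul (f g : Fock) :
    fockInner (halfNormSq * f) g = fockInner f (halfLaplacian g) := by
  simp only [halfNormSq, halfLaplacian_apply, smul_mul_assoc, Finset.sum_mul, sq, mul_assoc,
    fockInner_smul_left, fockInner_sum_left, fockInner_X_mul, fockInner_smul_right,
    fockInner_sum_right, map_div₀, map_one, Complex.conj_ofNat]

end FockScalarProduct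

section MatrixContraction

variable {ι κ n 𝕜 R S : Type*} [Fintype ι] [Fintype κ] [CommSemiring 𝕜]

/-- The matrix `∑_A u_A T^A` with entries in a module, for scalar matrices `T^A`. The field matrix
and the operator valued matrices `a†` and `a` are of this form. -/
def contract [AddCommMonoid R] [Module 𝕜 R] (T : ι → Matrix n n 𝕜) (u : ι → R) : Matrix n n R :=
  Matrix.of fun i j => ∑ A, T A i j • u A

theorem map_contract [AddCommMonoid R] [Module 𝕜 R] [AddCommMonoid S] [Module 𝕜 S]
    (T : ι → Matrix n n 𝕜) (u : ι → R) (f : R →ₗ[𝕜] S) :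
    (contract T u).map f = contract T fun A => f (u A) := by
  ext i j
  simp only [contract, Matrix.map_apply, Matrix.of_apply, map_sum, map_smul]

variable [Fintype n]

theorem trace_contract [AddCommMonoid R] [Module 𝕜 R] (T : ι → Matrix n n 𝕜) (u : ι → R) :
    (contract T u).trace = ∑ A, (T A).trace • u A := by
  simp only [contract, Matrix.trace, Matrix.diag, Matrix.of_apply, Finset.sum_smul]
  exact Finset.sum_comm

theorem contract_mul_contract [Semiring R] [Algebra 𝕜 R] (T : ι → Matrix n n 𝕜)
    (u : ι → R) (T' : κ → Matrix n n 𝕜) (u' : κ → R) :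
    contract T u * contract T' u' =
      contract (fun p : ι × κ => T p.1 * T' p.2) fun p => u p.1 * u' p.2 := by
  ext i j
  simp only [contract, Matrix.mul_apply, Matrix.of_apply, Finset.sum_mul_sum,
    Fintype.sum_prod_type, smul_mul_smul_comm, Finset.sum_smul]
  rw [Finset.sum_comm]
  exact Finset.sum_congr rfl fun A _ => Finset.sum_comm

theorem IsSU3Generators.trace_contract_mul_contract {R : Type*} [Ring R] [Algebra ℂ R]
    {T : Fin 8 → Matrix (Fin 3) (Fin 3) ℂ} (hT : IsSU3Generators T) (u v : Fin 8 → R) :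
    (contract T u * contract T v).trace = (1 / 2 : ℂ) • ∑ A, u A * v A := by
  rw [contract_mul_contract, trace_contract, Fintype.sum_prod_type, Finset.smul_sum]
  simp only [hT.trace_mul, ite_smul, zero_smul, Finset.sum_ite_eq, Finset.mem_univ, if_true]

end MatrixContraction

section Completeness

theorem sum_apply_mul_apply_of_trace_mul_eq {ι n R : Type*} [Fintype ι] [DecidableEq ι] [Fintype n]
    [DecidableEq n] [CommRing R] (hcard : Fintype.card ι = Fintype.card (n × n))
    {S T : ι → Matrix n n R} (hST : ∀ a b, (S a * T b).trace = if a = b then 1 else 0)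
    (i j k l : n) :
    ∑ a, S a i j * T a k l = if i = l ∧ j = k then 1 else 0 := by
  let V : Matrix ι (n × n) R := Matrix.of fun a p => S a p.1 p.2
  let W : Matrix (n × n) ι R := Matrix.of fun p a => T a p.2 p.1
  have hVW : V * W = 1 := by
    ext a b
    rw [Matrix.mul_apply, Fintype.sum_prod_type, Matrix.one_apply, ← hST a b]
    rfl
  have hWV : W * V = 1 := (Matrix.mul_eq_one_comm_of_card_eq _ _ _ hcard).1 hVW
  have hentry := congrFun (congrFun hWV (l, k)) (i, j)
  simp only [V, W, Matrix.mul_apply, Matrix.of_apply, Matrix.one_apply, Prod.mk.injEq] at hentry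
  rw [Finset.sum_congr rfl fun a _ => mul_comm _ _, hentry]
  exact if_congr (and_congr eq_comm eq_comm) rfl rfl

namespace IsSU3Generators

variable {T : Fin 8 → Matrix (Fin 3) (Fin 3) ℂ} (hT : IsSU3Generators T)

include hT

/-- Adjoining the identity to the generators gives a basis of the `3 × 3` matrices that is dual to
its own rescaling with respect to the trace form. -/
theorem completeness (i j k l : Fin 3) :
    ∑ A, T A i j * T A k l =
      (if i = l ∧ j = k then 1 / 2 else 0) - (if i = j ∧ k = l then 1 / 6 else 0) := by
  have hdual := sum_apply_mul_apply_of_trace_mul_eq (by simp)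
    (S := fun a : Option (Fin 8) => a.elim ((1 / 3 : ℂ) • 1) fun A => (2 : ℂ) • T A)
    (T := fun a : Option (Fin 8) => a.elim 1 T) (fun a b => ?_) i j k l
  · simp only [Fintype.sum_option, Option.elim, Matrix.smul_apply, Matrix.one_apply, smul_eq_mul,
      mul_assoc, ← Finset.mul_sum, ite_zero_mul_ite_zero, mul_one] at hdual
    split_ifs at hdual ⊢ <;> linear_combination (1 / 2 : ℂ) * hdual
  · rcases a with _ | A <;> rcases b with _ | B <;>
      simp [hT.trace_eq_zero, hT.trace_mul]

theorem sum_trace_mul_trace {R : Type*} [CommRing R] [Algebra ℂ R]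
    (M N : Matrix (Fin 3) (Fin 3) R) :
    ∑ A, ((T A).map (algebraMap ℂ R) * M).trace * ((T A).map (algebraMap ℂ R) * N).trace =
      (1 / 2 : ℂ) • (M * N).trace - (1 / 6 : ℂ) • (M.trace * N.trace) := by
  have htrace : ∀ (A : Fin 8) (M : Matrix (Fin 3) (Fin 3) R),
      ((T A).map (algebraMap ℂ R) * M).trace = ∑ p : Fin 3 × Fin 3, T A p.1 p.2 • M p.2 p.1 :=
    fun A M => by
      simp only [Matrix.trace, Matrix.diag, Matrix.mul_apply, Matrix.map_apply,
        Fintype.sum_prod_type, Algebra.smul_def]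
  calc ∑ A, ((T A).map (algebraMap ℂ R) * M).trace * ((T A).map (algebraMap ℂ R) * N).trace
      = ∑ p : Fin 3 × Fin 3, ∑ q : Fin 3 × Fin 3,
          (∑ A, T A p.1 p.2 * T A q.1 q.2) • (M p.2 p.1 * N q.2 q.1) := by
        simp only [htrace, Finset.sum_mul_sum, smul_mul_smul_comm, Finset.sum_smul]
        rw [Finset.sum_comm]
        exact Finset.sum_congr rfl fun p _ => Finset.sum_comm
    _ = (1 / 2 : ℂ) • (M * N).trace - (1 / 6 : ℂ) • (M.trace * N.trace) := by
        simp only [hT.completeness, sub_smul, ite_smul, zero_smul, Finset.sum_sub_distrib,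
          Fintype.sum_prod_type, ite_and, Finset.sum_ite_eq, Finset.mem_univ, if_true,
          Finset.sum_ite_irrel, Finset.sum_const_zero, Matrix.trace, Matrix.diag, Matrix.mul_apply,
          Finset.smul_sum, Finset.sum_mul_sum]
        rw [Finset.sum_comm]

theorem sum_mul_self : ∑ A, T A * T A = (4 / 3 : ℂ) • 1 := by
  ext i l
  simp only [Matrix.sum_apply, Matrix.mul_apply]
  rw [Finset.sum_comm]
  simp only [hT.completeness, and_true, ite_and, Finset.sum_sub_distrib, Finset.sum_const,
    Finset.sum_ite_eq, Finset.mem_univ, if_true, Finset.card_univ, Fintype.card_fin,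
    Matrix.smul_apply, Matrix.one_apply, smul_eq_mul, nsmul_eq_mul]
  split_ifs <;> norm_num

end IsSU3Generators

end Completeness

section MatrixDerivation

variable {l m n R A : Type*} [Fintype n] [CommSemiring R] [CommSemiring A] [Algebra R A]

theorem map_derivation_mul (D : Derivation R A A) (M : Matrix l n A) (N : Matrix n m A) :
    (M * N).map D = M.map D * N + M * N.map D := by
  ext i j
  simp only [Matrix.map_apply, Matrix.mul_apply, Matrix.add_apply, map_sum, Derivation.leibniz,
    smul_eq_mul, ← Finset.sum_add_distrib]
  exact Finset.sum_congr rfl fun k _ => by ring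

theorem derivation_trace (D : Derivation R A A) (M : Matrix n n A) :
    D M.trace = (M.map D).trace :=
  map_sum D _ _

theorem derivation_trace_mul_mul_self (D : Derivation R A A) (M : Matrix n n A) :
    D (M * M * M).trace = (3 : R) • (M.map D * (M * M)).trace := by
  rw [derivation_trace, map_derivation_mul, map_derivation_mul, Matrix.trace_add, add_mul,
    Matrix.trace_add, Matrix.trace_mul_cycle M, Matrix.trace_mul_comm (M * M), Matrix.mul_assoc]
  module

end MatrixDerivation

section Invariants

open MvPolynomial

variable (T : Fin 8 → Matrix (Fin 3) (Fin 3) ℂ)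

/-- The matrix `∑_A x_A T^A` of linear forms: the operator valued matrix `a†` acts as
multiplication by its entries. -/
def fieldMatrix : Matrix (Fin 3) (Fin 3) Fock :=
  contract T X

/-- The cubic invariant `tr (a†a†a†)` as a polynomial. -/
def cubicInvariant : Fock :=
  (fieldMatrix T * fieldMatrix T * fieldMatrix T).trace

theorem createMatrix_eq_map_lmul : createMatrix T = (fieldMatrix T).map (Algebra.lmul ℂ Fock) :=
  (map_contract T X (Algebra.lmul ℂ Fock).toLinearMap).symm

theorem trace_createMatrix_mul_mul_self :
    (createMatrix T * createMatrix T * createMatrix T).trace =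
      Algebra.lmul ℂ Fock (cubicInvariant T) := by
  rw [createMatrix_eq_map_lmul, ← Matrix.map_mul, ← Matrix.map_mul, cubicInvariant,
    AddMonoidHom.map_trace]

theorem cubicInvariant_eq_sum :
    cubicInvariant T =
      ∑ A, ∑ B, ∑ D, (T A * T B * T D).trace • (X A * X B * X D) := by
  rw [cubicInvariant, fieldMatrix, contract_mul_contract, contract_mul_contract, trace_contract,
    Fintype.sum_prod_type, Fintype.sum_prod_type]

theorem isHomogeneous_cubicInvariant : (cubicInvariant T).IsHomogeneous 3 := by
  rw [cubicInvariant_eq_sum]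
  refine .sum _ _ _ fun A _ => .sum _ _ _ fun B _ => .sum _ _ _ fun D _ => ?_
  rw [smul_eq_C_mul]
  simpa only [zero_add] using (isHomogeneous_C _ _).mul
    (((isHomogeneous_X ℂ A).mul (isHomogeneous_X ℂ B)).mul (isHomogeneous_X ℂ D))

theorem map_pderiv_fieldMatrix (A : Fin 8) :
    (fieldMatrix T).map (pderiv A) = (T A).map (algebraMap ℂ Fock) := by
  classical
  rw [fieldMatrix]
  refine (map_contract T X (pderiv A).toLinearMap).trans ?_
  ext i j : 2
  simp only [contract, Matrix.of_apply, Matrix.map_apply, Derivation.coeFn_coe, pderiv_X,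
    Pi.single_apply, smul_ite, smul_zero, Finset.sum_ite_eq', Finset.mem_univ, if_true,
    Algebra.algebraMap_eq_smul_one]

theorem pderiv_cubicInvariant (A : Fin 8) :
    pderiv A (cubicInvariant T) = (3 : ℂ) •
      ((T A).map (algebraMap ℂ Fock) * (fieldMatrix T * fieldMatrix T)).trace := by
  rw [cubicInvariant, derivation_trace_mul_mul_self, map_pderiv_fieldMatrix]

theorem pderiv_pderiv_cubicInvariant (A : Fin 8) :
    pderiv A (pderiv A (cubicInvariant T)) =
      (6 : ℂ) • ((T A * T A).map (algebraMap ℂ Fock) * fieldMatrix T).trace := by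
  have hconst : ((T A).map (algebraMap ℂ Fock)).map (pderiv A) = 0 := by
    exact Matrix.ext fun i j => pderiv_C
  rw [pderiv_cubicInvariant, Derivation.map_smul, derivation_trace, map_derivation_mul,
    map_derivation_mul, map_pderiv_fieldMatrix, hconst, zero_mul, zero_add, mul_add,
    Matrix.trace_add, ← mul_assoc _ (fieldMatrix T), Matrix.trace_mul_cycle _ (fieldMatrix T),
    ← mul_assoc, Matrix.map_mul]
  module

theorem two_mul_trace_pow_four {R : Type*} [CommRing R] {M : Matrix (Fin 3) (Fin 3) R}
    (hM : M.trace = 0) : 2 * (M * M * (M * M)).trace = (M * M).trace * (M * M).trace := by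
  have hM₂₂ : M 2 2 = -M 0 0 - M 1 1 := by
    rw [Matrix.trace_fin_three] at hM
    linear_combination hM
  simp only [Matrix.trace_fin_three, Matrix.mul_apply, Fin.sum_univ_three, hM₂₂]
  ring

variable {T} (hT : IsSU3Generators T)

include hT

theorem trace_createMatrix_mul_self :
    (createMatrix T * createMatrix T).trace = Algebra.lmul ℂ Fock halfNormSq := by
  refine (hT.trace_contract_mul_contract create create).trans ?_
  simp only [halfNormSq, map_smul, map_sum, sq, map_mul]
  rfl

theorem fockState_eq (j k : ℕ) :
    fockState T j k = halfNormSq ^ j * cubicInvariant T ^ k := by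
  rw [fockState, trace_createMatrix_mul_self hT, trace_createMatrix_mul_mul_self, ← map_pow,
    ← map_pow, ← map_mul, Algebra.coe_lmul_eq_mul, LinearMap.mul_apply', mul_one]

theorem hamiltonian_apply (f : Fock) :
    hamiltonian T f = (1 / 2 : ℂ) • gradInner halfNormSq f + (2 : ℂ) • f
      - (1 / 2 : ℂ) • (halfNormSq * f) - (1 / 2 : ℂ) • halfLaplacian f := by
  have hnumber : (createMatrix T * annihilateMatrix T).trace =
      (1 / 2 : ℂ) • ∑ A, create A * annihilate A :=
    hT.trace_contract_mul_contract create annihilate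
  have hannihilate : (annihilateMatrix T * annihilateMatrix T).trace = halfLaplacian :=
    hT.trace_contract_mul_contract annihilate annihilate
  simp only [hamiltonian, hnumber, hannihilate, trace_createMatrix_mul_self hT, gradInner,
    pderiv_halfNormSq, LinearMap.sub_apply, LinearMap.add_apply, LinearMap.smul_apply,
    LinearMap.sum_apply, Module.End.one_apply, Module.End.mul_apply]
  rfl

theorem trace_fieldMatrix : (fieldMatrix T).trace = 0 := by
  rw [fieldMatrix, trace_contract]
  exact Finset.sum_eq_zero fun A _ => by rw [hT.trace_eq_zero, zero_smul]

theorem trace_fieldMatrix_mul_self : (fieldMatrix T * fieldMatrix T).trace = halfNormSq := by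
  rw [fieldMatrix, hT.trace_contract_mul_contract, halfNormSq]
  simp only [sq]

theorem gradInner_cubicInvariant_self :
    gradInner (cubicInvariant T) (cubicInvariant T) = (3 / 4 : ℂ) • halfNormSq ^ 2 := by
  have hpow := two_mul_trace_pow_four (trace_fieldMatrix hT)
  simp only [gradInner, pderiv_cubicInvariant, smul_mul_smul_comm, ← Finset.smul_sum,
    hT.sum_trace_mul_trace, trace_fieldMatrix_mul_self hT, two_mul, sq] at hpow ⊢
  linear_combination (norm := module) (9 / 4 : ℂ) • hpow

theorem halfLaplacian_cubicInvariant : halfLaplacian (cubicInvariant T) = 0 := by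
  rw [halfLaplacian_apply]
  simp only [pderiv_pderiv_cubicInvariant, ← Finset.smul_sum, ← Matrix.trace_sum, ← Finset.sum_mul]
  have hcasimir : ∑ A, (T A * T A).map (algebraMap ℂ Fock) =
      (4 / 3 : ℂ) • (1 : Matrix (Fin 3) (Fin 3) Fock) := by
    have hmap := congrArg (Algebra.ofId ℂ Fock).mapMatrix hT.sum_mul_self
    rwa [map_sum, map_smul, map_one] at hmap
  rw [hcasimir, smul_mul_assoc, one_mul, Matrix.trace_smul, trace_fieldMatrix hT, smul_zero,
    smul_zero, smul_zero]

end Invariants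

section CubicAdjoint

open MvPolynomial

variable {T : Fin 8 → Matrix (Fin 3) (Fin 3) ℂ} (hT : IsSU3Generators T)

include hT

theorem IsSU3Generators.conj_trace_mul_mul (A B D : Fin 8) :
    conj (T A * T B * T D).trace = (T D * T B * T A).trace := by
  rw [starRingEnd_apply, ← Matrix.trace_conjTranspose, Matrix.conjTranspose_mul,
    Matrix.conjTranspose_mul, (hT.isHermitian A).eq, (hT.isHermitian B).eq,
    (hT.isHermitian D).eq, mul_assoc]

/-- The adjoint of the multiplication by `tr (a†a†a†)` is `tr (aaa)`; since `tr (aa)` is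
`halfLaplacian`, on harmonic polynomials it is a triple commutator of `halfLaplacian` with the
multiplication. -/
theorem fockInner_cubicInvariant_mul (f : Fock) {g : Fock} (hg : halfLaplacian g = 0) :
    fockInner (cubicInvariant T * f) g = fockInner f ((1 / 6 : ℂ) •
      halfLaplacian (halfLaplacian (halfLaplacian (cubicInvariant T * g)))) := by
  simp only [cubicInvariant_eq_sum, Finset.sum_mul, smul_mul_assoc, mul_assoc, map_sum, map_smul,
    halfLaplacian_X_mul_X_mul_X_mul hg, Finset.smul_sum, fockInner_sum_left, fockInner_sum_right,
    fockInner_smul_left, fockInner_smul_right, fockInner_X_mul]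
  simp only [← mul_assoc (T _), hT.conj_trace_mul_mul]
  rw [Finset.sum_congr rfl fun A _ => Finset.sum_comm, Finset.sum_comm]
  refine Finset.sum_congr rfl fun D _ => ?_
  rw [Finset.sum_comm]
  refine Finset.sum_congr rfl fun B _ => Finset.sum_congr rfl fun A _ => ?_
  ring

end CubicAdjoint

section RadialMultiples

theorem fockInner_halfNormSq_mul_eq_zero (f : Fock) {g : Fock} (hg : halfLaplacian g = 0) :
    fockInner (halfNormSq * f) g = 0 := by
  rw [fockInner_halfNormSq_mul, hg, fockInner_zero_right]

theorem fockInner_halfNormSq_pow_mul {f g : Fock} {e : ℕ} (hf : halfLaplacian f = 0)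
    (hg : g.IsHomogeneous e) (hg₀ : halfLaplacian g = 0) (n m : ℕ) :
    fockInner (halfNormSq ^ n * f) (halfNormSq ^ m * g) =
      if n = m then (n ! * (e + 4).ascFactorial n : ℂ) * fockInner f g else 0 := by
  induction n generalizing m with
  | zero =>
    rcases m with _ | m
    · simp
    · rw [← conj_fockInner, pow_zero, one_mul, pow_succ', mul_assoc,
        fockInner_halfNormSq_mul_eq_zero _ hf, map_zero, if_neg m.succ_ne_zero.symm]
  | succ n ih =>
    rw [pow_succ', mul_assoc]
    rcases m with _ | m
    · rw [pow_zero, one_mul, fockInner_halfNormSq_mul_eq_zero _ hg₀, if_neg n.succ_ne_zero]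
    · rw [fockInner_halfNormSq_mul, halfLaplacian_halfNormSq_pow_succ_mul hg hg₀,
        fockInner_smul_right, ih]
      simp only [Nat.add_right_cancel_iff]
      split_ifs with hnm
      · subst hnm
        rw [Nat.factorial_succ, Nat.ascFactorial_succ, Fintype.card_fin]
        push_cast
        ring
      · rw [mul_zero]

theorem cutProjection_of_isHomogeneous {f : Fock} {n : ℕ} (hf : f.IsHomogeneous n) (N : ℕ) :
    cutProjection N f = if n ≤ N then f else 0 := by
  simp only [cutProjection, LinearMap.sum_apply, MvPolynomial.homogeneousComponent_of_mem hf,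
    Finset.sum_ite_eq', Finset.mem_range, Nat.lt_succ_iff]

variable {T : Fin 8 → Matrix (Fin 3) (Fin 3) ℂ} (hT : IsSU3Generators T)

include hT

theorem hamiltonian_apply_of_isHomogeneous {f : Fock} {e : ℕ} (hf : f.IsHomogeneous e) :
    hamiltonian T f = (e / 2 + 2 : ℂ) • f - (1 / 2 : ℂ) • (halfNormSq * f)
      - (1 / 2 : ℂ) • halfLaplacian f := by
  rw [hamiltonian_apply hT, gradInner_halfNormSq_left hf]
  module

theorem hamiltonian_sum_halfNormSq_pow_mul {f : Fock} {e : ℕ} (hf : f.IsHomogeneous e)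
    (hf₀ : halfLaplacian f = 0) {E : ℂ} {s : ℕ → ℂ} (hs : IsSonineSeq (e + 3) (2 * E) s) (d : ℕ) :
    hamiltonian T (∑ n ∈ Finset.range (d + 1), s n • (halfNormSq ^ n * f)) =
      E • ∑ n ∈ Finset.range (d + 1), s n • (halfNormSq ^ n * f)
        - (s d / 2) • (halfNormSq ^ (d + 1) * f)
        + ((d + 1) * (d + e + 4) / 2 * s (d + 1)) • (halfNormSq ^ d * f) := by
  have hH : ∀ n : ℕ, hamiltonian T (halfNormSq ^ n * f) =
      (n + e / 2 + 2 : ℂ) • (halfNormSq ^ n * f) - (1 / 2 : ℂ) • (halfNormSq ^ (n + 1) * f)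
        - (1 / 2 : ℂ) • halfLaplacian (halfNormSq ^ n * f) := fun n => by
    rw [hamiltonian_apply_of_isHomogeneous hT (isHomogeneous_halfNormSq_pow_mul hf n), pow_succ',
      mul_assoc]
    push_cast
    module
  induction d with
  | zero =>
    have hone := hs.one
    rw [zero_add, Finset.sum_range_one, map_smul, hH, pow_zero, one_mul, hf₀]
    push_cast at hone ⊢
    linear_combination (norm := module) (-1 / 2 : ℂ) • hone • f
  | succ d ih =>
    have hadd_two := hs.add_two d
    rw [Finset.sum_range_succ, map_add, ih, map_smul, hH,
      halfLaplacian_halfNormSq_pow_succ_mul hf hf₀, Fintype.card_fin]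
    push_cast at hadd_two ⊢
    linear_combination (norm := module) (-1 / 2 : ℂ) • hadd_two • (halfNormSq ^ (d + 1) * f)

theorem cutHamiltonian_sum_halfNormSq_pow_mul {f : Fock} {e : ℕ} (hf : f.IsHomogeneous e)
    (hf₀ : halfLaplacian f = 0) {E : ℂ} {s : ℕ → ℂ} (hs : IsSonineSeq (e + 3) (2 * E) s)
    {N d : ℕ} (hd : 2 * d + e ≤ N) (hd' : N < 2 * (d + 1) + e) (hsd : s (d + 1) = 0) :
    cutHamiltonian T N (∑ n ∈ Finset.range (d + 1), s n • (halfNormSq ^ n * f)) =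
      E • ∑ n ∈ Finset.range (d + 1), s n • (halfNormSq ^ n * f) := by
  have hcut : ∀ n, cutProjection N (halfNormSq ^ n * f) =
      if 2 * n + e ≤ N then halfNormSq ^ n * f else 0 := fun n =>
    cutProjection_of_isHomogeneous (isHomogeneous_halfNormSq_pow_mul hf n) N
  rw [cutHamiltonian, Module.End.mul_apply, hamiltonian_sum_halfNormSq_pow_mul hT hf hf₀ hs, hsd,
    mul_zero, zero_smul, add_zero, map_sub, map_smul, map_smul, hcut, if_neg hd'.not_ge, smul_zero,
    sub_zero, map_sum]
  congr 1
  refine Finset.sum_congr rfl fun n hn => ?_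
  rw [map_smul, hcut, if_pos (by have := Finset.mem_range.1 hn; omega)]

end RadialMultiples

section InvariantHarmonics

open MvPolynomial

variable (T : Fin 8 → Matrix (Fin 3) (Fin 3) ℂ)

/-- The harmonic polynomial of degree `3 k` in the algebra generated by the quadratic and the cubic
invariant, with leading term the `k`-th power of the cubic invariant. -/
def harmonic : ℕ → Fock
  | 0 => 1
  | 1 => cubicInvariant T
  | k + 2 => cubicInvariant T * harmonic (k + 1) - (1 / 24 : ℂ) • (halfNormSq ^ 3 * harmonic k)

theorem cubicInvariant_mul_harmonic_succ (k : ℕ) :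
    cubicInvariant T * harmonic T (k + 1) =
      harmonic T (k + 2) + (1 / 24 : ℂ) • (halfNormSq ^ 3 * harmonic T k) :=
  (sub_add_cancel _ _).symm

theorem isHomogeneous_harmonic (k : ℕ) : (harmonic T k).IsHomogeneous (3 * k) := by
  induction k using Nat.twoStepInduction with
  | zero => exact isHomogeneous_one _ _
  | one => exact isHomogeneous_cubicInvariant T
  | more k ih₀ ih₁ =>
    have hcubic := (isHomogeneous_cubicInvariant T).mul ih₁
    have hquadratic := (isHomogeneous_C (Fin 8) (1 / 24 : ℂ)).mul
      (isHomogeneous_halfNormSq_pow_mul ih₀ 3)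
    rw [show 3 + 3 * (k + 1) = 3 * (k + 2) by ring] at hcubic
    rw [show 0 + (2 * 3 + 3 * k) = 3 * (k + 2) by ring, ← smul_eq_C_mul] at hquadratic
    exact hcubic.sub hquadratic

variable {T}

theorem fockInner_harmonic_succ (k : ℕ) {g : Fock} (hg : halfLaplacian g = 0) :
    fockInner (harmonic T (k + 1)) g = fockInner (cubicInvariant T * harmonic T k) g := by
  rcases k with _ | k
  · rw [harmonic, harmonic, mul_one]
  · rw [harmonic, fockInner_sub_left, fockInner_smul_left, pow_succ', mul_assoc,
      fockInner_halfNormSq_mul_eq_zero _ hg, mul_zero, sub_zero]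

variable (hT : IsSU3Generators T)

include hT

/-- The quadratic correction in the recurrence for `harmonic` is chosen so that the two
contributions `|∇ cubicInvariant|²` and `∇ cubicInvariant · ∇ halfNormSq` combine. -/
theorem gradInner_cubicInvariant_harmonic_succ (k : ℕ) :
    gradInner (cubicInvariant T) (harmonic T (k + 1)) =
      (3 * (k + 2) / 8 : ℂ) • (halfNormSq ^ 2 * harmonic T k) := by
  have hself := gradInner_cubicInvariant_self hT
  have hnormSq : gradInner (cubicInvariant T) halfNormSq = (3 : ℂ) • cubicInvariant T := by
    rw [gradInner_comm, gradInner_halfNormSq_left (isHomogeneous_cubicInvariant T), Nat.cast_ofNat]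
  have hcube : ∀ f : Fock, gradInner (cubicInvariant T) (halfNormSq ^ 3 * f) =
      (9 : ℂ) • (halfNormSq ^ 2 * (cubicInvariant T * f)) +
        halfNormSq ^ 3 * gradInner (cubicInvariant T) f := fun f => by
    simp only [pow_succ, pow_zero, one_mul, gradInner_mul_right, hnormSq]
    algebra
  have hrec : ∀ k, gradInner (cubicInvariant T) (harmonic T (k + 2)) =
      (3 / 4 : ℂ) • (halfNormSq ^ 2 * harmonic T (k + 1)) +
        cubicInvariant T * gradInner (cubicInvariant T) (harmonic T (k + 1)) -
        (1 / 24 : ℂ) • ((9 : ℂ) • (halfNormSq ^ 2 * (cubicInvariant T * harmonic T k)) +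
          halfNormSq ^ 3 * gradInner (cubicInvariant T) (harmonic T k)) := fun k => by
    rw [harmonic, gradInner_sub_right, gradInner_smul_right, hcube, gradInner_mul_right, hself,
      smul_mul_assoc]
  induction k using Nat.twoStepInduction with
  | zero =>
    simp only [harmonic, hself, mul_one]
    push_cast
    module
  | one =>
    rw [hrec]
    simp only [harmonic, hself, gradInner_one_right]
    push_cast
    algebra
  | more k ih₀ ih₁ =>
    rw [hrec, ih₁, ih₀, cubicInvariant_mul_harmonic_succ]
    simp only [mul_smul_comm, mul_left_comm (cubicInvariant T), cubicInvariant_mul_harmonic_succ]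
    push_cast
    algebra

theorem halfLaplacian_harmonic (k : ℕ) : halfLaplacian (harmonic T k) = 0 := by
  induction k using Nat.twoStepInduction with
  | zero => exact halfLaplacian_one
  | one => exact halfLaplacian_cubicInvariant hT
  | more k ih₀ ih₁ =>
    rw [harmonic, map_sub, map_smul, halfLaplacian_mul, ih₁, halfLaplacian_cubicInvariant hT,
      mul_zero, zero_mul, gradInner_cubicInvariant_harmonic_succ hT,
      halfLaplacian_halfNormSq_pow_succ_mul (isHomogeneous_harmonic T k) ih₀, Fintype.card_fin]
    push_cast
    module

theorem halfLaplacian_halfNormSq_pow_succ_mul_harmonic (n k : ℕ) :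
    halfLaplacian (halfNormSq ^ (n + 1) * harmonic T k) =
      ((n + 1) * (n + 3 * k + 4) : ℂ) • (halfNormSq ^ n * harmonic T k) := by
  rw [halfLaplacian_halfNormSq_pow_succ_mul (isHomogeneous_harmonic T k)
    (halfLaplacian_harmonic hT k), Fintype.card_fin]
  push_cast
  module

theorem fockInner_harmonic_succ_harmonic_zero (k : ℕ) :
    fockInner (harmonic T (k + 1)) (harmonic T 0) = 0 := by
  rw [fockInner_harmonic_succ k (halfLaplacian_harmonic hT 0),
    fockInner_cubicInvariant_mul hT _ (halfLaplacian_harmonic hT 0), harmonic, mul_one,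
    halfLaplacian_cubicInvariant hT, map_zero, map_zero, smul_zero, fockInner_zero_right]

theorem fockInner_harmonic_succ_succ (k l : ℕ) :
    fockInner (harmonic T (k + 1)) (harmonic T (l + 1)) =
      ((3 * l + 4) * (3 * l + 5) * (3 * l + 6) / 24) * fockInner (harmonic T k) (harmonic T l) := by
  have hharmonic := halfLaplacian_harmonic hT
  rw [fockInner_harmonic_succ k (hharmonic _), fockInner_cubicInvariant_mul hT _ (hharmonic _),
    cubicInvariant_mul_harmonic_succ, map_add, hharmonic, zero_add, ← fockInner_smul_right]
  congr 1
  simp only [map_smul, halfLaplacian_halfNormSq_pow_succ_mul_harmonic hT, pow_zero, one_mul]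
  push_cast
  module

theorem fockInner_harmonic (a b : ℕ) :
    fockInner (harmonic T a) (harmonic T b) =
      if a = b then (1 / 6 : ℂ) * (1 / 24 ^ a) * ((3 * a + 3)! : ℂ) else 0 := by
  induction a generalizing b with
  | zero =>
    rcases b with _ | b
    · rw [harmonic, fockInner_one_one]
      norm_num [Nat.factorial]
    · rw [← conj_fockInner, fockInner_harmonic_succ_harmonic_zero hT, map_zero,
        if_neg b.succ_ne_zero.symm]
  | succ a ih =>
    rcases b with _ | b
    · rw [fockInner_harmonic_succ_harmonic_zero hT, if_neg a.succ_ne_zero]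
    · rw [fockInner_harmonic_succ_succ hT, ih]
      simp only [Nat.add_right_cancel_iff]
      split_ifs with hab
      · subst hab
        rw [show 3 * (a + 1) + 3 = 3 * a + 3 + 1 + 1 + 1 by ring]
        simp only [Nat.factorial_succ, pow_succ]
        push_cast
        field_simp
        ring
      · rw [mul_zero]

end InvariantHarmonics

section OrthogonalizedFockStates

open Finset.HasAntidiagonal (antidiagonal)

theorem eq_sum_choose_of_recurrence {R : Type*} [CommRing R] {b c : R} {u : ℕ → R}
    (hu₀ : u 0 = 1) (hu₁ : u 1 = c) (hu : ∀ k, u (k + 2) = c * u (k + 1) + b * u k) (k : ℕ) :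
    u k = ∑ p ∈ antidiagonal k, (p.2.choose p.1 : R) * b ^ p.1 * c ^ (p.2 - p.1) := by
  induction k using Nat.twoStepInduction with
  | zero => simp [hu₀]
  | one => simp [hu₁, Finset.Nat.antidiagonal_succ]
  | more k ih₀ ih₁ =>
    have hterm : ∀ i j : ℕ, c * ((j.choose (i + 1) : R) * b ^ (i + 1) * c ^ (j - (i + 1))) +
        b * ((j.choose i : R) * b ^ i * c ^ (j - i)) =
        ((j + 1).choose (i + 1) : R) * b ^ (i + 1) * c ^ (j + 1 - (i + 1)) := fun i j => by
      rw [Nat.choose_succ_succ, Nat.cast_add, Nat.add_sub_add_right]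
      rcases lt_or_ge i j with hij | hij
      · rw [show j - i = j - (i + 1) + 1 by omega]
        ring
      · rw [Nat.choose_eq_zero_of_lt (Nat.lt_succ_of_le hij)]
        ring
    rw [hu, ih₁, ih₀, Finset.Nat.sum_antidiagonal_succ (n := k),
      Finset.Nat.sum_antidiagonal_succ (n := k + 1), Finset.Nat.sum_antidiagonal_succ' (n := k),
      mul_add, Finset.mul_sum, Finset.mul_sum, add_assoc, ← Finset.sum_add_distrib]
    simp only [hterm, Nat.choose_zero_right, Nat.choose_zero_succ, Nat.sub_zero]
    ring

theorem gammaEven_sub {κ t : ℕ} (ht : t ≤ κ) :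
    gammaEven κ (κ - t) = (-1 / 24 : ℝ) ^ t * ((2 * κ - t).choose t : ℝ) := by
  have hexponent : ((κ - t : ℕ) : ℤ) - (κ : ℤ) = -(t : ℤ) := by omega
  rw [gammaEven, hexponent, zpow_neg, zpow_natCast, show κ + (κ - t) = 2 * κ - t by omega,
    show κ - (κ - t) = t by omega, Nat.cast_choose ℝ (show t ≤ 2 * κ - t by omega),
    show 2 * (κ - t) = 2 * κ - t - t by omega, ← inv_pow, mul_div_assoc]
  norm_num

theorem gammaEven_self (κ : ℕ) : gammaEven κ κ = 1 := by
  simpa using gammaEven_sub (Nat.zero_le κ)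

variable {T : Fin 8 → Matrix (Fin 3) (Fin 3) ℂ}

variable (T) in
theorem barState_eq_sum_range (n κ : ℕ) :
    barState T n κ = ∑ t ∈ Finset.range (κ + 1),
      ((gammaEven κ (κ - t) : ℝ) : ℂ) • fockState T (n + 3 * t) (2 * (κ - t)) := by
  rw [Finset.range_eq_Ico, Finset.sum_eq_sum_Ico_succ_bot κ.succ_pos, barState]
  simp only [Nat.mul_sub, gammaEven_self, Nat.sub_zero, mul_zero, add_zero, Complex.ofReal_one,
    one_smul]
  rfl

theorem harmonic_eq_sum (k : ℕ) :
    harmonic T k = ∑ p ∈ antidiagonal k, ((-1 / 24) ^ p.1 * p.2.choose p.1 : ℂ) •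
      (halfNormSq ^ (3 * p.1) * cubicInvariant T ^ (p.2 - p.1)) := by
  rw [eq_sum_choose_of_recurrence (u := harmonic T) (b := (-1 / 24 : ℂ) • halfNormSq ^ 3)
    (c := cubicInvariant T) rfl rfl fun k => ?_]
  · refine Finset.sum_congr rfl fun p _ => ?_
    rw [smul_pow, ← pow_mul]
    algebra
  · rw [smul_mul_assoc, cubicInvariant_mul_harmonic_succ]
    module

theorem barState_eq (hT : IsSU3Generators T) (n κ : ℕ) :
    barState T n κ = halfNormSq ^ n * harmonic T (2 * κ) := by
  rw [barState_eq_sum_range, harmonic_eq_sum, Finset.mul_sum,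
    Finset.Nat.sum_antidiagonal_eq_sum_range_succ_mk,
    ← Finset.sum_subset (Finset.range_subset_range.2 (show κ + 1 ≤ (2 * κ).succ by omega))]
  · refine Finset.sum_congr rfl fun t ht => ?_
    rw [gammaEven_sub (Nat.lt_succ_iff.1 (Finset.mem_range.1 ht)), fockState_eq hT, mul_smul_comm,
      ← mul_assoc, ← pow_add, Nat.mul_sub, two_mul t, Nat.sub_sub]
    push_cast
    rfl
  · intro t _ ht
    rw [Nat.choose_eq_zero_of_lt (by rw [Finset.mem_range] at ht; omega), Nat.cast_zero, mul_zero,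
      zero_smul, mul_zero]

theorem fockInner_barState (hT : IsSU3Generators T) (α β n m : ℕ) :
    fockInner (barState T n α) (barState T m β) =
      if α = β ∧ n = m then
        (1 / 6 : ℂ) * (1 / 24 ^ (2 * α)) * (n ! : ℂ) * ((n + 6 * α + 3)! : ℂ)
      else 0 := by
  rw [barState_eq hT, barState_eq hT, fockInner_halfNormSq_pow_mul (halfLaplacian_harmonic hT _)
    (isHomogeneous_harmonic T _) (halfLaplacian_harmonic hT _), fockInner_harmonic hT]
  simp only [Nat.mul_left_cancel_iff two_pos, ite_and]
  split_ifs with hnm hαβ hαβ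
  · subst hαβ
    have hfactorial := Nat.factorial_mul_ascFactorial (3 * (2 * α) + 3) n
    rw [show n + 6 * α + 3 = 3 * (2 * α) + 3 + n by ring, ← hfactorial]
    push_cast
    ring
  · exact mul_zero _
  · rfl
  · rfl

end OrthogonalizedFockStates

section EnergyStates

variable {T : Fin 8 → Matrix (Fin 3) (Fin 3) ℂ}

section

variable (hT : IsSU3Generators T)

include hT

theorem cutHamiltonian_energyState {N κ : ℕ} (hκ : κ ≤ N / 6) {e : ℝ}
    (he : sonine (dim N κ) (6 * κ + 3) (2 * e) = 0) :
    cutHamiltonian T N (energyState T N κ e) = (e : ℂ) • energyState T N κ e := by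
  have hs := (isSonineSeq_sonine (6 * κ + 3) (2 * e)).map Complex.ofRealHom
  simp only [map_mul, map_ofNat, Complex.ofRealHom_eq_coe] at hs
  have hf := isHomogeneous_harmonic T (2 * κ)
  rw [show 3 * (2 * κ) = 6 * κ by ring] at hf
  simp only [energyState, barState_eq hT]
  rw [map_smul, smul_comm, dim, cutHamiltonian_sum_halfNormSq_pow_mul hT hf
    (halfLaplacian_harmonic hT _) hs (by omega) (by omega)
    (Complex.ofReal_eq_zero.2 he)]

theorem fockInner_energyState_of_ne (N : ℕ) {κ κ' : ℕ} (h : κ ≠ κ') (e e' : ℝ) :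
    fockInner (energyState T N κ e) (energyState T N κ' e') = 0 := by
  simp only [energyState, fockInner_smul_left, fockInner_smul_right, fockInner_sum_left,
    fockInner_sum_right, fockInner_barState hT, h, false_and, if_false, mul_zero,
    Finset.sum_const_zero]

theorem fockInner_energyState (N κ : ℕ) (e e' : ℝ) :
    fockInner (energyState T N κ e) (energyState T N κ e') =
      (((2 * e) ^ (3 * κ) * Real.exp (-e) * ((2 * e') ^ (3 * κ) * Real.exp (-e')) *
        (1 / 6 * (1 / 24 ^ (2 * κ))) *
        ∑ n ∈ Finset.range (dim N κ), (n ! : ℝ) * (n + (6 * κ + 3))! *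
          (sonine n (6 * κ + 3) (2 * e) * sonine n (6 * κ + 3) (2 * e')) : ℝ) : ℂ) := by
  have horth : Pairwise fun n m => fockInner (barState T n κ) (barState T m κ) = 0 :=
    fun n m hnm => (fockInner_barState hT κ κ n m).trans (if_neg fun h => hnm h.2)
  simp only [energyState, fockInner_smul_left, fockInner_smul_right,
    fockInner_sum_smul_sum_smul_of_pairwise horth, fockInner_barState hT, and_self, if_true,
    Complex.conj_ofReal, add_assoc]
  push_cast
  simp only [Finset.mul_sum]
  exact Finset.sum_congr rfl fun n _ => by ring

theorem fockInner_energyState_eq_zero {N κ : ℕ} {e e' : ℝ} (hne : e ≠ e')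
    (he : sonine (dim N κ) (6 * κ + 3) (2 * e) = 0)
    (he' : sonine (dim N κ) (6 * κ + 3) (2 * e') = 0) :
    fockInner (energyState T N κ e) (energyState T N κ e') = 0 := by
  have hcd := (isSonineSeq_sonine (6 * κ + 3) (2 * e)).christoffel_darboux
    (isSonineSeq_sonine (6 * κ + 3) (2 * e')) ((N - 6 * κ) / 2)
  rw [← dim, he, he', mul_zero, zero_mul, sub_zero, mul_zero] at hcd
  have hsub : 2 * e - 2 * e' ≠ 0 := sub_ne_zero.2 fun h => hne (mul_left_cancel₀ two_ne_zero h)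
  rw [fockInner_energyState hT, (mul_eq_zero.1 hcd).resolve_left hsub, mul_zero,
    Complex.ofReal_zero]

theorem fockInner_energyState_self {N κ : ℕ} {e : ℝ}
    (he : sonine (dim N κ) (6 * κ + 3) (2 * e) = 0) :
    fockInner (energyState T N κ e) (energyState T N κ e) =
      ((Real.exp (-(2 * e)) * (2 * e) ^ (6 * κ) * (1 / 6) * (1 / 24 ^ (2 * κ)) *
        (((dim N κ)! : ℝ) / ((dim N κ + 6 * κ + 2)! : ℝ)) *
        (laguerre (dim N κ - 1) (6 * κ + 3)).eval (2 * e) *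
        (laguerre (dim N κ - 1) (6 * κ + 4)).eval (2 * e) : ℝ) : ℂ) := by
  have hsum := sum_sonine_sq_of_isRoot (sonine_eq_zero_iff.1 he)
  simp only [pow_two] at hsum
  rw [fockInner_energyState hT, dim, hsum, Nat.add_sub_cancel,
    show -(2 * e) = -e + -e by ring, Real.exp_add, show 6 * κ = 3 * κ + 3 * κ by ring, pow_add,
    show ∀ d k : ℕ, d + 1 + k + 2 = d + (k + 3) from fun d k => by ring]
  congr 1
  ring

theorem fockInner_energyState_self_ne_zero {N κ : ℕ} {e : ℝ} (he : 0 < e) :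
    fockInner (energyState T N κ e) (energyState T N κ e) ≠ 0 := by
  have hsum := sum_sonine_sq_pos (6 * κ + 3) (2 * e) ((N - 6 * κ) / 2)
  simp only [pow_two] at hsum
  rw [fockInner_energyState hT, Complex.ofReal_ne_zero]
  exact (mul_pos (by positivity) hsum).ne'

theorem energyState_ne_zero {N κ : ℕ} {e : ℝ} (he : 0 < e) : energyState T N κ e ≠ 0 := fun h =>
  fockInner_energyState_self_ne_zero hT (N := N) (κ := κ) he (by rw [h, fockInner_zero_right])

end

end EnergyStates

section EnergyLevels

theorem existsUnique_strictMono_range_eq {α : Type*} [LinearOrder α] {s : Finset α} {d : ℕ}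
    (hs : s.card = d) : ∃! f : Fin d → α, StrictMono f ∧ Set.range f = s :=
  ⟨s.orderEmbOfFin hs, ⟨(s.orderEmbOfFin hs).strictMono, s.range_orderEmbOfFin hs⟩,
    fun _ hf => Finset.orderEmbOfFin_unique hs (fun i => hf.2.le (Set.mem_range_self i)) hf.1⟩

theorem exists_finset_sonine_two_mul_eq_zero (n a : ℕ) :
    ∃ s : Finset ℝ, s.card = n ∧ (s : Set ℝ) = {e : ℝ | sonine n a (2 * e) = 0} := by
  refine ⟨(laguerre n a).roots.toFinset.map (Equiv.mulLeft₀ 2 two_ne_zero).symm.toEmbedding,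
    ?_, Set.ext fun e => ?_⟩
  · rw [Finset.card_map, Multiset.toFinset_card_of_nodup (nodup_roots_laguerre n a),
      card_roots_laguerre]
  · rw [Finset.mem_coe, Finset.mem_map_equiv, Equiv.symm_symm, Multiset.mem_toFinset,
      Polynomial.mem_roots (laguerre_ne_zero n a), ← sonine_eq_zero_iff]
    rfl

theorem existsUnique_isEnergyLevels (N : ℕ) :
    ∃! E : (κ : Fin (N / 6 + 1)) → Fin (dim N κ) → ℝ, IsEnergyLevels N E := by
  have hlevels : ∀ κ : Fin (N / 6 + 1), ∃! e : Fin (dim N κ) → ℝ,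
      StrictMono e ∧ Set.range e = {e : ℝ | sonine (dim N κ) (6 * κ + 3) (2 * e) = 0} := fun κ => by
    obtain ⟨s, hcard, hs⟩ := exists_finset_sonine_two_mul_eq_zero (dim N κ) (6 * κ + 3)
    rw [← hs]
    exact existsUnique_strictMono_range_eq hcard
  choose E hE hE_unique using hlevels
  exact ⟨E, hE, fun E' hE' => funext fun κ => hE_unique κ _ (hE' κ)⟩

namespace IsEnergyLevels

variable {N : ℕ} {E : (κ : Fin (N / 6 + 1)) → Fin (dim N κ) → ℝ} (hE : IsEnergyLevels N E)

include hE

theorem sonine_eq_zero (κ : Fin (N / 6 + 1)) (m : Fin (dim N κ)) :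
    sonine (dim N κ) (6 * (κ : ℕ) + 3) (2 * E κ m) = 0 :=
  (hE κ).2.le (Set.mem_range_self m)

theorem pos (κ : Fin (N / 6 + 1)) (m : Fin (dim N κ)) : 0 < E κ m := by
  have hroot := sonine_eq_zero_iff.1 (hE.sonine_eq_zero κ m)
  have hpos := pos_of_mem_roots_laguerre ((Polynomial.mem_roots (laguerre_ne_zero _ _)).2 hroot)
  linarith

variable {T : Fin 8 → Matrix (Fin 3) (Fin 3) ℂ} (hT : IsSU3Generators T)

include hT

theorem fockInner_energyState_of_ne {i j : Label N} (hij : i ≠ j) :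
    fockInner (energyState T N i.1 (E i.1 i.2)) (energyState T N j.1 (E j.1 j.2)) = 0 := by
  obtain ⟨κ, m⟩ := i
  obtain ⟨κ', m'⟩ := j
  rcases eq_or_ne κ κ' with rfl | hκ
  · exact fockInner_energyState_eq_zero hT
      ((hE κ).1.injective.ne fun h => hij (congrArg (Sigma.mk κ) h))
      (hE.sonine_eq_zero κ m) (hE.sonine_eq_zero κ m')
  · exact SYMQM.fockInner_energyState_of_ne hT N (Fin.val_injective.ne hκ) _ _

theorem linearIndependent_energyState :
    LinearIndependent ℂ fun i : Label N => energyState T N i.1 (E i.1 i.2) :=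
  LinearMap.linearIndependent_of_isOrthoᵢ (B := fockForm)
    (fun _ _ hij => hE.fockInner_energyState_of_ne hT hij)
    fun i => fockInner_energyState_self_ne_zero hT (hE.pos i.1 i.2)

end IsEnergyLevels

end EnergyLevels

section TransformationMatrices

variable (T : Fin 8 → Matrix (Fin 3) (Fin 3) ℂ) {N : ℕ}

theorem lt_dim_iff {N κ n : ℕ} (hκ : κ ≤ N / 6) : n < dim N κ ↔ 2 * n + 6 * κ ≤ N := by
  rw [dim]
  omega

theorem barState_eq_sum_matrixT₁ (i : Label N) : barState T i.2 i.1 =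
    ∑ j : Label N, ((matrixT₁ N i j : ℝ) : ℂ) • fockState T j.2 (2 * (j.1 : ℕ)) := by
  obtain ⟨⟨κ, hκ⟩, ⟨n, hn⟩⟩ := i
  simp only [matrixT₁, Matrix.of_apply, apply_ite Complex.ofReal, Complex.ofReal_zero, ite_smul,
    zero_smul]
  rw [← Finset.sum_filter, barState_eq_sum_range]
  symm
  refine Finset.sum_bij (fun j _ => κ - (j.1 : ℕ)) (fun j _ => Finset.mem_range.2 (by omega))
    ?_ ?_ ?_
  · rintro ⟨⟨k, hk⟩, ⟨m, hm⟩⟩ hj ⟨⟨k', hk'⟩, ⟨m', hm'⟩⟩ hj' hsub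
    simp only [Finset.mem_filter, Finset.mem_univ, true_and] at hj hj' hsub
    obtain rfl : k = k' := by omega
    obtain rfl : m = m' := by omega
    rfl
  · intro t ht
    rw [Finset.mem_range] at ht
    have hn' := (lt_dim_iff (Nat.lt_succ_iff.1 hκ)).1 hn
    have hlt : n + 3 * t < dim N (κ - t) := (lt_dim_iff (by omega)).2 (by omega)
    refine ⟨⟨⟨κ - t, by omega⟩, ⟨n + 3 * t, hlt⟩⟩, ?_, ?_⟩
    · simp only [Finset.mem_filter, Finset.mem_univ, true_and]
      omega
    · exact Nat.sub_sub_self (Nat.lt_succ_iff.1 ht)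
  · rintro ⟨⟨k, hk⟩, ⟨m, hm⟩⟩ hj
    simp only [Finset.mem_filter, Finset.mem_univ, true_and] at hj ⊢
    rw [hj.2, Nat.sub_sub_self hj.1]

theorem matrixT₁_self (i : Label N) : matrixT₁ N i i = 1 := by
  simp [matrixT₁, gammaEven_self]

theorem matrixT₁_eq_zero_of_lex {i j : Label N}
    (hij : Sigma.Lex (· < ·) (fun _ => (· < ·)) i j) : matrixT₁ N i j = 0 := by
  rw [matrixT₁, Matrix.of_apply, if_neg]
  rintro ⟨hle, heq⟩
  rcases hij with ⟨_, _, hlt⟩ | ⟨_, _, hlt⟩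
  · exact hle.not_gt hlt
  · have := Fin.lt_def.1 hlt
    simp only [tsub_self, mul_zero, add_zero] at heq
    omega

theorem det_matrixT₁ (N : ℕ) : (matrixT₁ N).det = 1 := by
  rw [← Matrix.det_submatrix_equiv_self (ofLex (α := Label N)) (matrixT₁ N),
    Matrix.det_of_isLowerTriangular]
  · exact Finset.prod_eq_one fun i _ => matrixT₁_self _
  · exact fun _ _ hij => matrixT₁_eq_zero_of_lex hij

theorem energyState_eq_sum_matrixT₂ (E : (κ : Fin (N / 6 + 1)) → Fin (dim N κ) → ℝ)
    (i : Label N) : energyState T N i.1 (E i.1 i.2) =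
      ∑ j : Label N, ((matrixT₂ N E i j : ℝ) : ℂ) • barState T j.2 j.1 := by
  obtain ⟨κ, m⟩ := i
  rw [Fintype.sum_sigma, Fintype.sum_eq_single κ fun κ' hne => ?_]
  · simp only [matrixT₂, Matrix.blockDiagonal'_apply_eq, Matrix.diagonal_mul, laguerreMatrix,
      Matrix.of_apply, energyState, Finset.smul_sum, Finset.sum_range, smul_smul,
      Complex.ofReal_mul]
  · refine Finset.sum_eq_zero fun n _ => ?_
    rw [matrixT₂, Matrix.blockDiagonal'_apply_ne _ _ _ hne.symm, Complex.ofReal_zero, zero_smul]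

theorem energyState_eq_sum_matrixT₂_mul_matrixT₁
    (E : (κ : Fin (N / 6 + 1)) → Fin (dim N κ) → ℝ) (i : Label N) :
    energyState T N i.1 (E i.1 i.2) =
      ∑ j : Label N, (((matrixT₂ N E * matrixT₁ N) i j : ℝ) : ℂ) •
        fockState T j.2 (2 * (j.1 : ℕ)) := by
  simp only [energyState_eq_sum_matrixT₂, barState_eq_sum_matrixT₁, Finset.smul_sum, smul_smul,
    Matrix.mul_apply, Complex.ofReal_sum, Complex.ofReal_mul, Finset.sum_smul]
  exact Finset.sum_comm

theorem IsEnergyLevels.det_matrixT₂_ne_zero {E : (κ : Fin (N / 6 + 1)) → Fin (dim N κ) → ℝ}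
    (hE : IsEnergyLevels N E) : (matrixT₂ N E).det ≠ 0 := by
  have hblock : ∀ κ, (Matrix.diagonal (fun m => (2 * E κ m) ^ (3 * (κ : ℕ)) *
      Real.exp (-(E κ m))) * laguerreMatrix κ (E κ)).det ≠ 0 := fun κ => by
    rw [Matrix.det_mul, Matrix.det_diagonal]
    refine mul_ne_zero (Finset.prod_ne_zero_iff.2 fun m _ => ?_)
      (det_laguerreMatrix_ne_zero _ (hE κ).1)
    have := hE.pos κ m
    positivity
  have hunit := Pi.isUnit_iff.2 fun κ =>
    (Matrix.isUnit_iff_isUnit_det _).2 (isUnit_iff_ne_zero.2 (hblock κ))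
  exact isUnit_iff_ne_zero.1
    ((Matrix.isUnit_iff_isUnit_det _).1 (hunit.map (Matrix.blockDiagonal'RingHom _ ℝ)))

end TransformationMatrices

section EvenSector

section SpanRange

variable {K V ι : Type*} [Field K] [AddCommGroup V] [Module K V] [Finite ι] {v w : ι → V}

theorem span_range_eq_of_linearIndependent (hv : LinearIndependent K v)
    (hvw : ∀ i, v i ∈ Submodule.span K (Set.range w)) :
    Submodule.span K (Set.range v) = Submodule.span K (Set.range w) := by
  have := Fintype.ofFinite ι
  have := FiniteDimensional.span_of_finite K (Set.finite_range w)
  exact Submodule.eq_of_le_of_finrank_le (Submodule.span_le.2 (Set.range_subset_iff.2 hvw))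
    ((finrank_range_le_card w).trans_eq (finrank_span_eq_card hv).symm)

theorem linearIndependent_of_mem_span_range (hv : LinearIndependent K v)
    (hvw : ∀ i, v i ∈ Submodule.span K (Set.range w)) : LinearIndependent K w := by
  have := Fintype.ofFinite ι
  rw [linearIndependent_iff_card_eq_finrank_span, Set.finrank,
    ← span_range_eq_of_linearIndependent hv hvw, finrank_span_eq_card hv]

end SpanRange

variable {T : Fin 8 → Matrix (Fin 3) (Fin 3) ℂ}

theorem evenSector_eq_span_range (T : Fin 8 → Matrix (Fin 3) (Fin 3) ℂ) (N : ℕ) :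
    evenSector T N =
      Submodule.span ℂ (Set.range fun i : Label N => fockState T i.2 (2 * (i.1 : ℕ))) := by
  rw [evenSector]
  congr 1
  ext v
  constructor
  · rintro ⟨j, k, hjk, rfl⟩
    exact ⟨⟨⟨k, by omega⟩, ⟨j, (lt_dim_iff (κ := k) (by omega)).2 (by omega)⟩⟩, rfl⟩
  · rintro ⟨⟨⟨k, hk⟩, ⟨j, hj⟩⟩, rfl⟩
    have hj' := (lt_dim_iff (Nat.lt_succ_iff.1 hk)).1 hj
    exact ⟨j, k, by omega, rfl⟩

theorem energyState_mem_span_fockState (T : Fin 8 → Matrix (Fin 3) (Fin 3) ℂ) {N : ℕ}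
    (E : (κ : Fin (N / 6 + 1)) → Fin (dim N κ) → ℝ) (i : Label N) :
    energyState T N i.1 (E i.1 i.2) ∈
      Submodule.span ℂ (Set.range fun j : Label N => fockState T j.2 (2 * (j.1 : ℕ))) := by
  rw [energyState_eq_sum_matrixT₂_mul_matrixT₁]
  exact Submodule.sum_smul_mem _ _ fun j _ => Submodule.subset_span (Set.mem_range_self j)

theorem linearIndependent_fockState (hT : IsSU3Generators T) (N : ℕ) :
    LinearIndependent ℂ fun i : Label N => fockState T i.2 (2 * (i.1 : ℕ)) := by
  obtain ⟨E, hE, -⟩ := existsUnique_isEnergyLevels N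
  exact linearIndependent_of_mem_span_range (hE.linearIndependent_energyState hT)
    (energyState_mem_span_fockState T E)

theorem IsEnergyLevels.span_energyState {N : ℕ} {E : (κ : Fin (N / 6 + 1)) → Fin (dim N κ) → ℝ}
    (hE : IsEnergyLevels N E) (hT : IsSU3Generators T) :
    Submodule.span ℂ (Set.range fun i : Label N => energyState T N i.1 (E i.1 i.2)) =
      evenSector T N := by
  rw [evenSector_eq_span_range]
  exact span_range_eq_of_linearIndependent (hE.linearIndependent_energyState hT)
    (energyState_mem_span_fockState T E)

end EvenSector

end SYMQM

end

open SYMQM in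
theorem mainTheorem8 (T : Fin 8 → Matrix (Fin 3) (Fin 3) ℂ) (hT : IsSU3Generators T) (N : ℕ) :
    -- scalar products of the orthogonalized Fock states
    (∀ α β n m : ℕ, fockInner (barState T n α) (barState T m β) =
      if α = β ∧ n = m then
        (1 / 6 : ℂ) * (1 / 24 ^ (2 * α)) * (n ! : ℂ) * ((n + 6 * α + 3)! : ℂ)
      else 0) ∧
    -- simplicity and positivity of the roots in the quantization conditions
    (∀ κ : ℕ, κ ≤ N / 6 →
      (laguerre (dim N κ) (6 * κ + 3)).natDegree = dim N κ ∧
      (laguerre (dim N κ) (6 * κ + 3)).roots.card = dim N κ ∧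
      (laguerre (dim N κ) (6 * κ + 3)).roots.Nodup ∧
      ∀ x ∈ (laguerre (dim N κ) (6 * κ + 3)).roots, 0 < x) ∧
    (∃! E : (κ : Fin (N / 6 + 1)) → Fin (dim N κ) → ℝ, IsEnergyLevels N E) ∧
    ∀ E : (κ : Fin (N / 6 + 1)) → Fin (dim N κ) → ℝ, IsEnergyLevels N E →
      -- the states are eigenstates of the cut Hamiltonian
      (∀ i : Label N, energyState T N i.1 (E i.1 i.2) ≠ 0 ∧
        cutHamiltonian T N (energyState T N i.1 (E i.1 i.2)) =
          ((E i.1 i.2 : ℝ) : ℂ) • energyState T N i.1 (E i.1 i.2)) ∧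
      -- orthogonality, across families and within each family
      (∀ i j : Label N, i ≠ j →
        fockInner (energyState T N i.1 (E i.1 i.2)) (energyState T N j.1 (E j.1 j.2)) = 0) ∧
      -- norms
      (∀ i : Label N,
        fockInner (energyState T N i.1 (E i.1 i.2)) (energyState T N i.1 (E i.1 i.2)) =
          ((Real.exp (-(2 * E i.1 i.2)) * (2 * E i.1 i.2) ^ (6 * (i.1 : ℕ)) *
            (1 / 6) * (1 / 24 ^ (2 * (i.1 : ℕ))) *
            (((dim N i.1)! : ℝ) / ((dim N i.1 + 6 * (i.1 : ℕ) + 2)! : ℝ)) *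
            (laguerre (dim N i.1 - 1) (6 * (i.1 : ℕ) + 3)).eval (2 * E i.1 i.2) *
            (laguerre (dim N i.1 - 1) (6 * (i.1 : ℕ) + 4)).eval (2 * E i.1 i.2) : ℝ) : ℂ)) ∧
      -- the transformation from the Fock states is `T₂ * T₁`, with `T₁` unitriangular
      (∀ i : Label N, barState T i.2 i.1 =
        ∑ j : Label N, ((matrixT₁ N i j : ℝ) : ℂ) • fockState T j.2 (2 * (j.1 : ℕ))) ∧
      (∀ i : Label N, matrixT₁ N i i = 1) ∧
      (∀ i j : Label N, Sigma.Lex (· < ·) (fun _ => (· < ·)) i j → matrixT₁ N i j = 0) ∧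
      (∀ i : Label N, energyState T N i.1 (E i.1 i.2) =
        ∑ j : Label N, ((matrixT₂ N E i j : ℝ) : ℂ) • barState T j.2 j.1) ∧
      (∀ i : Label N, energyState T N i.1 (E i.1 i.2) =
        ∑ j : Label N, (((matrixT₂ N E * matrixT₁ N) i j : ℝ) : ℂ) •
          fockState T j.2 (2 * (j.1 : ℕ))) ∧
      -- the blocks of `T₂` have Vandermonde determinants, and the transformation is nonsingular
      (∀ κ : Fin (N / 6 + 1),
        (laguerreMatrix κ (E κ)).det =
          (∏ k : Fin (dim N κ), (-1 : ℝ) ^ (k : ℕ) /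
            (((k : ℕ)! : ℝ) * ((6 * (κ : ℕ) + 3 + (k : ℕ))! : ℝ))) *
            ∏ i : Fin (dim N κ), ∏ j ∈ Finset.Ioi i, (2 * E κ j - 2 * E κ i) ∧
        (laguerreMatrix κ (E κ)).det ≠ 0) ∧
      (matrixT₁ N).det = 1 ∧
      (matrixT₂ N E * matrixT₁ N).det ≠ 0 ∧
      -- both the Fock states and the energy eigenstates are bases of the even sector
      LinearIndependent ℂ (fun i : Label N => fockState T i.2 (2 * (i.1 : ℕ))) ∧
      LinearIndependent ℂ (fun i : Label N => energyState T N i.1 (E i.1 i.2)) ∧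
      Submodule.span ℂ (Set.range fun i : Label N => energyState T N i.1 (E i.1 i.2)) =
        evenSector T N := by
  refine ⟨fockInner_barState hT, fun κ _ => ⟨natDegree_laguerre _ _, card_roots_laguerre _ _,
    nodup_roots_laguerre _ _, fun _ => pos_of_mem_roots_laguerre⟩,
    existsUnique_isEnergyLevels N, fun E hE => ?_⟩
  have heigen : ∀ i : Label N, energyState T N i.1 (E i.1 i.2) ≠ 0 ∧
      cutHamiltonian T N (energyState T N i.1 (E i.1 i.2)) =
        ((E i.1 i.2 : ℝ) : ℂ) • energyState T N i.1 (E i.1 i.2) := fun i =>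
    ⟨energyState_ne_zero hT (hE.pos i.1 i.2),
      cutHamiltonian_energyState hT (Nat.lt_succ_iff.1 i.1.2) (hE.sonine_eq_zero i.1 i.2)⟩
  have hdet : (matrixT₂ N E * matrixT₁ N).det ≠ 0 := by
    rw [Matrix.det_mul, det_matrixT₁, mul_one]
    exact hE.det_matrixT₂_ne_zero
  exact ⟨heigen, fun _ _ hij => hE.fockInner_energyState_of_ne hT hij,
    fun i => fockInner_energyState_self hT (hE.sonine_eq_zero i.1 i.2),
    barState_eq_sum_matrixT₁ T, matrixT₁_self, fun _ _ => matrixT₁_eq_zero_of_lex,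
    energyState_eq_sum_matrixT₂ T E, energyState_eq_sum_matrixT₂_mul_matrixT₁ T E,
    fun κ => ⟨det_laguerreMatrix _ _, det_laguerreMatrix_ne_zero _ (hE κ).1⟩,
    det_matrixT₁ N, hdet, linearIndependent_fockState hT N,
    hE.linearIndependent_energyState hT, hE.span_energyState hT⟩
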